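/- Let $V$ be a finite linearly ordered vertex set, $\Delta\ge 0$, let the color palette be $\mathcal C=\{0,\dots,\Delta\}$, the top level $\lambda=\max(5,\lceil\log_3\Delta\rceil)$ (with $\lambda=5$ if $\Delta=0$), and the bottom level $b\in\{1,\dots,5\}$. A dynamic graph $G$ on $V$ starts empty and undergoes a fixed (oblivious) sequence of batches $S_1,\dots,S_T$; each batch inserts some absent edges and deletes some present ones, and after each batch the maximum degree is at most $\Delta$. Every vertex $u$ has a level $\ell(u)\in\{b,\dots,\lambda\}$; $N_u(1,j)$ is the set of neighbors of $u$ of level at most $j$. The *upper condition* for $u$ is $|N_u(1,\ell(u))|\le 3^{\ell(u)+2}$; the *lower condition* is $|N_u(1,\ell(u)-1)|\ge 3^{\ell(u)-5}$ if $\ell(u)>b$ (no condition if $\ell(u)=b$). A vertex is *clean* if it satisfies both and *dirty* otherwise. A color is *blank* (*unique*) for $u$ if no neighbor of level $\ge\ell(u)$ has it and no (exactly one) neighbor of level $<\ell(u)$ has it. Consider the following randomized algorithm. Initially all vertices have level $5$ and independent uniform colors. A batch is processed in three phases. *Initialization.* Apply the batch to $G$. Of every inserted edge with equally colored ends, the end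 that was recolored most recently becomes blank (uncolored); vertices last colored deterministically count as the most recent, otherwise recency is given by the batch number and, inside a batch, by the level (a lower level is later), and ties are broken by the order of $V$. Whenever a vertex of level $i$ becomes blank, it enters $\mathrm{Mrkd}_U(i)$ if it violates the upper condition, $\mathrm{Mrkd}_L(i)$ if it violates only the lower condition, and $\mathrm{Unmrkd}(i)$ if it is clean. *Coloring.* For $i=\lambda,\dots,b$: first color $H=\mathrm{Mrkd}_U(i)\cup\mathrm{Mrkd}_L(i)$ (these recolorings count as deterministic), where each $u\in H$ starts with the palette of the first $\deg_H(u)+1$ blank colors of $u$. Repeat until $H$ is empty: all $u\in H$ choose independent uniform colors from their palettes, those whose color was not chosen by a neighbor in $H$ keep it and leave $H$, and the others remove the colors of their newly colored neighbors from their palettes. Then color $H=\mathrm{Unmrkd}(i)$ by the same kind of rounds, where in each round the palette of $u$ is recomputed as its first $\max(\deg_H(u)+1,\lfloor 3^{\max(i-5,0)}/2\rfloor+1)$ blank or unique colors; if $u$ obtains a unique color, the one lower neighbor having that color becomes blank. ("First" refers to an arbitrary order of the colors, which may depend on the vertex and on the execution so far.) *Moving.* Raising, for $i=\lambda,\dots,b$: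 let $U=\mathrm{Mrkd}_U(i)$; for $k=\lambda,\dots,i+1$, start with $U^+=U$, and until $U^+$ is empty, discard (for this $k$) all $u\in U^+$ that do not satisfy $|N_u(1,k-1)|\ge 3^{k-1}$ and $|N_u(1,k)|\le 3^k$, sample each remaining vertex independently with probability $1/24$, and move to level $k$ all sampled vertices with at most $3^{k-1}/4$ sampled neighbors, removing them from $U^+$ and $U$. Lowering, for $i=b,\dots,\lambda$: sample each vertex of $\mathrm{Mrkd}_L(i)$ independently with probability $1/(2\cdot 3^6)$ and move to level $\max(b,i-4)$ all sampled vertices with at most $3^{i-4}$ sampled neighbors. Every recoloring of a vertex $u$ is recorded as a timestamp $\tau$; let $\ell(\tau)$ be the level of $u$ at that time, $b(\tau)=\max(\lfloor\log_3|N_u(1,\ell(\tau))|\rfloor,\ell(\tau))$ its base level (read as $\ell(\tau)$ if the neighborhood is empty), and $\ell'(\tau)$ the level of $u$ at the end of the moving phase of that batch. The cost of $\tau$ is $w(\tau)=3^{\max(b(\tau),\ell'(\tau))}$, and its movement cost is $w^M(\tau)=3^{\max(\ell(\tau),\ell'(\tau))}$ if $\ell'(\tau)\ne\ell(\tau)$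 and $w^M(\tau)=0$ if $u$ was not moved. Let $D_T$ be the set of all timestamps, over the $T$ batches, at which the recolored vertex was dirty, and let $w(D_T)=\sum_{\tau\in D_T}w(\tau)$, $w^M(D_T)=\sum_{\tau\in D_T}w^M(\tau)$. **Lemma.** There is an absolute constant $C$ such that, for all $V$, $\Delta$, $b$, all orders of the colors, and all such sequences of batches, $$\mathbf E[w(D_T)]\;\le\; C\cdot \mathbf E[w^M(D_T)].$$ -/

import Mathlib

open scoped ENNReal NNReal

noncomputable section

namespace BatchColoring

/-! ### Discrete probability -/

/-- The expectation of a nonnegative random variable under a discrete law. -/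
def expect {σ : Type*} (p : PMF σ) (X : σ → ℝ≥0∞) : ℝ≥0∞ := ∑' s, p s * X s

open scoped Classical in
/-- The law of the state of the loop "while `c` do `f`", started in a given state,
after at most `n` executions of its body. -/
def loopIter {σ : Type*} (c : σ → Prop) (f : σ → PMF σ) : ℕ → σ → PMF σ
  | 0, s => PMF.pure s
  | n + 1, s => if c s then (f s).bind (loopIter c f n) else PMF.pure s

open scoped Classical in
/-- The probability that the loop "while `c` do `f`", started in `s`, stops in `t`
after at most `n` executions of its body. -/
def stopMass {σ : Type*} (c : σ → Prop) (f : σ → PMF σ) (n : ℕ) (s t : σ) : ℝ≥0∞ :=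
  if c t then 0 else loopIter c f n s t

theorem stopMass_le_succ {σ : Type*} (c : σ → Prop) (f : σ → PMF σ) (n : ℕ) (s t : σ) :
    stopMass c f n s t ≤ stopMass c f (n + 1) s t := by
  unfold stopMass
  split_ifs with ht
  · exact le_rfl
  · induction n generalizing s with
    | zero =>
      by_cases hs : c s
      · have hne : t ≠ s := fun h => ht (h ▸ hs)
        simp [loopIter, hne]
      · simp [loopIter, hs]
    | succ n ih =>
      rw [loopIter, loopIter]
      split_ifs with hs
      · rw [PMF.bind_apply, PMF.bind_apply]
        exact ENNReal.tsum_le_tsum fun a => by gcongr; exact ih a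
      · exact le_rfl

theorem stopMass_mono {σ : Type*} (c : σ → Prop) (f : σ → PMF σ) (s t : σ) :
    Monotone fun n => stopMass c f n s t :=
  monotone_nat_of_le_succ fun n => stopMass_le_succ c f n s t

theorem tsum_stopMass_le_one {σ : Type*} (c : σ → Prop) (f : σ → PMF σ) (s : σ) :
    ∑' t, ⨆ n, stopMass c f n s t ≤ 1 := by
  rw [ENNReal.tsum_eq_iSup_sum]
  refine iSup_le fun F => ?_
  rw [ENNReal.finsetSum_iSup_of_monotone fun t => stopMass_mono c f s t]
  refine iSup_le fun n => ?_
  calc ∑ t ∈ F, stopMass c f n s t ≤ ∑ t ∈ F, loopIter c f n s t := by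
        refine Finset.sum_le_sum fun t _ => ?_
        unfold stopMass
        split_ifs
        · exact zero_le
        · exact le_rfl
    _ ≤ ∑' t, loopIter c f n s t := ENNReal.sum_le_tsum F
    _ = 1 := PMF.tsum_coe _

open scoped Classical in
/-- The law of the state in which the randomized loop "while `c` do `f`", started in `s`, stops.
Should the loop run forever with positive probability, that missing probability is put on the
starting state; for a loop that stops almost surely this convention plays no role. -/
def whileLoop {σ : Type*} (c : σ → Prop) (f : σ → PMF σ) (s : σ) : PMF σ :=
  ⟨fun t => (⨆ n, stopMass c f n s t) +
      (if t = s then 1 - ∑' r, ⨆ n, stopMass c f n s r else 0), by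
    refine (ENNReal.summable.hasSum_iff).2 ?_
    rw [ENNReal.tsum_add, tsum_ite_eq]
    exact add_tsub_cancel_of_le (tsum_stopMass_le_one c f s)⟩

/-- "for `i` in the list do `f i`". -/
def forLoop {σ : Type*} (f : ℕ → σ → PMF σ) : List ℕ → σ → PMF σ
  | [], s => PMF.pure s
  | i :: l, s => (f i s).bind (forLoop f l)

/-- Every element of `U` is selected independently with probability `1 / n`. -/
def sample {V : Type*} [Fintype V] [DecidableEq V] (n : ℕ) [NeZero n] (U : Finset V) :
    PMF (Finset V) :=
  (PMF.uniformOfFintype (V → Fin n)).map fun f => U.filter fun u => f u = 0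

/-! ### Dynamic graphs -/

/-- A batch of edge updates: the inserted and the deleted edges. -/
structure Batch (V : Type*) where
  ins : Finset (Sym2 V)
  del : Finset (Sym2 V)

/-- The graph after the batch. -/
def Batch.apply {V : Type*} (B : Batch V) (G : SimpleGraph V) : SimpleGraph V :=
  SimpleGraph.fromEdgeSet ((G.edgeSet \ (B.del : Set (Sym2 V))) ∪ (B.ins : Set (Sym2 V)))

/-- The batches only insert absent edges and delete present ones, and the graph, which is `G`
at the start, has maximum degree at most `Δ` after each of them. -/
def Valid {V : Type*} (Δ : ℕ) : SimpleGraph V → List (Batch V) → Prop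
  | _, [] => True
  | G, B :: l =>
      (∀ e ∈ B.ins, ¬ e.IsDiag ∧ e ∉ G.edgeSet) ∧ (∀ e ∈ B.del, e ∈ G.edgeSet) ∧
      (∀ v, ((B.apply G).neighborSet v).ncard ≤ Δ) ∧ Valid Δ (B.apply G) l

/-! ### The state of the algorithm -/

/-- An entry of the record of a vertex: its level when it is recolored, its base level and whether
it is dirty at that time, and the level on which it ends up after potentially moving. -/
structure Stamp where
  level : ℕ
  base : ℕ
  final : ℕ
  dirty : Prop

/-- The total cost of a (dirty) entry of the record. -/
def Stamp.cost (τ : Stamp) : ℕ := 3 ^ max τ.base τ.final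

open scoped Classical in
/-- The movement cost of an entry of the record: moving a vertex from level `i` to level `k` costs
`3 ^ max i k`, and a vertex that does not move has no movement cost. -/
def Stamp.moveCost (τ : Stamp) : ℕ :=
  if τ.final = τ.level then 0 else 3 ^ max τ.level τ.final

/-- Times of recoloring: `⊤` means "deterministically", and `(k, i)` means "at random, in batch
`k`, on level `i`". Inside a batch the levels are processed from the top downwards, so that a
lower level means a later time. -/
abbrev Time := WithTop (ℕ ×ₗ ℕᵒᵈ)

/-- The state of the algorithm. `color u = none` means that `u` is blank.
`mrkdU i`, `mrkdL i`, `unmrkd i` are the vertices of level `i` that were made blank in the current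
batch and are upper marked, lower marked, and unmarked. `record u` is the record of `u`, newest
entry first. `hist` logs all previous graphs, levels and colorings. -/
structure State (V : Type*) (Δ : ℕ) where
  graph : SimpleGraph V
  level : V → ℕ
  color : V → Option (Fin (Δ + 1))
  time : V → Time
  mrkdU : ℕ → Finset V
  mrkdL : ℕ → Finset V
  unmrkd : ℕ → Finset V
  record : V → List Stamp
  hist : List (SimpleGraph V × (V → ℕ) × (V → Option (Fin (Δ + 1))))

/-- The top level: `⌈log₃ Δ⌉`, but at least the initial level `5`. -/
def topLevel (Δ : ℕ) : ℕ := max 5 (Nat.clog 3 Δ)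

/-- The levels from `a` to `b` in increasing order. -/
def levelsUp (a b : ℕ) : List ℕ := List.range' a (b + 1 - a)

/-- The levels from `b` down to `a`. -/
def levelsDown (a b : ℕ) : List ℕ := (levelsUp a b).reverse

/-- How the arrays that store the palettes order the colors. The order may depend on the vertex,
on the state and, through `hist`, on the past. -/
abbrev Arrangement (V : Type*) (Δ : ℕ) := State V Δ → V → Equiv.Perm (Fin (Δ + 1))

section Algorithm

open scoped Classical

variable {V : Type*} [Fintype V] [LinearOrder V] {Δ : ℕ}

namespace State

/-- The neighbors of `u` on the levels up to `j`. -/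
def below (s : State V Δ) (u : V) (j : ℕ) : Finset V :=
  Finset.univ.filter fun v => s.graph.Adj u v ∧ s.level v ≤ j

/-- The upper condition. -/
def Upper (s : State V Δ) (u : V) : Prop :=
  (s.below u (s.level u)).card ≤ 3 ^ (s.level u + 2)

/-- The lower condition; `b` is the bottom level. -/
def Lower (b : ℕ) (s : State V Δ) (u : V) : Prop :=
  b < s.level u →
    (3 : ℝ) ^ ((s.level u : ℤ) - 5) ≤ ((s.below u (s.level u - 1)).card : ℝ)

/-- A vertex is clean if it satisfies both conditions, and dirty otherwise. -/
def Clean (b : ℕ) (s : State V Δ) (u : V) : Prop := s.Upper u ∧ s.Lower b u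

/-- The base level of `u`. -/
def baseLevel (s : State V Δ) (u : V) : ℕ :=
  max (Nat.log 3 (s.below u (s.level u)).card) (s.level u)

/-- The colors of the neighbors of `u` that are not below `u`. -/
def upColors (s : State V Δ) (u : V) : Finset (Fin (Δ + 1)) :=
  Finset.univ.filter fun c =>
    ∃ v, s.graph.Adj u v ∧ s.level u ≤ s.level v ∧ s.color v = some c

/-- The neighbors below `u` of color `c`. -/
def lowerWith (s : State V Δ) (u : V) (c : Fin (Δ + 1)) : Finset V :=
  (s.below u (s.level u - 1)).filter fun v => s.color v = some c

/-- The colors that are blank for `u`. -/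
def blank (s : State V Δ) (u : V) : Finset (Fin (Δ + 1)) :=
  Finset.univ.filter fun c => c ∉ s.upColors u ∧ (s.lowerWith u c).card = 0

/-- The colors that are unique for `u`. -/
def unique (s : State V Δ) (u : V) : Finset (Fin (Δ + 1)) :=
  Finset.univ.filter fun c => c ∉ s.upColors u ∧ (s.lowerWith u c).card = 1

/-- The log, extended by the present configuration. -/
def log (s : State V Δ) : List (SimpleGraph V × (V → ℕ) × (V → Option (Fin (Δ + 1)))) :=
  (s.graph, s.level, s.color) :: s.hist

/-- Make the vertices of `A` blank and enter each of them in the right table. -/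
def uncolor (b : ℕ) (A : Finset V) (s : State V Δ) : State V Δ :=
  { s with
    color := fun v => if v ∈ A then none else s.color v
    mrkdU := fun j => s.mrkdU j ∪ A.filter fun v => s.level v = j ∧ ¬ s.Upper v
    mrkdL := fun j => s.mrkdL j ∪ A.filter fun v => s.level v = j ∧ s.Upper v ∧ ¬ s.Lower b v
    unmrkd := fun j => s.unmrkd j ∪ A.filter fun v => s.level v = j ∧ s.Clean b v }

/-- Move the vertices of `M` to level `k`. -/
def moveTo (M : Finset V) (k : ℕ) (s : State V Δ) : State V Δ :=
  { s with
    level := fun v => if v ∈ M then k else s.level v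
    hist := s.log }

/-- The entry of the record for a vertex `u` that was recolored in the present batch; `s` is the
state after the coloring phase of the batch and `s'` the state at its end. -/
def stamp (b : ℕ) (s s' : State V Δ) (u : V) : Stamp where
  level := s.level u
  base := s.baseLevel u
  final := s'.level u
  dirty := ¬ s.Clean b u

/-- The vertices recolored in the present batch. -/
def recolored (s : State V Δ) : Finset V :=
  Finset.univ.filter fun u => ∃ i, u ∈ s.mrkdU i ∨ u ∈ s.mrkdL i ∨ u ∈ s.unmrkd i

/-- The sum of `f` over the dirty entries of the record. -/
def sumDirty (f : Stamp → ℕ) (s : State V Δ) : ℝ≥0∞ :=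
  ∑ u, ((((s.record u).filter fun τ => τ.dirty).map f).sum : ℝ≥0∞)

end State

/-! ### Initialization phase -/

/-- The endpoints of inserted monochromatic edges that were recolored most recently; the order of
the vertices breaks ties. -/
def conflicts (B : Batch V) (s : State V Δ) : Finset V :=
  Finset.univ.filter fun x => ∃ y, s(x, y) ∈ B.ins ∧ s.color x = s.color y ∧
    (s.time y < s.time x ∨ (s.time y = s.time x ∧ y < x))

/-- Apply the batch to the graph, make one endpoint of every monochromatic inserted edge blank, and
set up the tables. -/
def initPhase (b : ℕ) (B : Batch V) (s : State V Δ) : State V Δ :=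
  State.uncolor b (conflicts B s)
    { s with
      graph := B.apply s.graph
      mrkdU := fun _ => ∅
      mrkdL := fun _ => ∅
      unmrkd := fun _ => ∅
      hist := s.log }

/-! ### Coloring phase -/

/-- The first `m` elements of `S` in the order given by `p`. -/
def firstOf (p : Equiv.Perm (Fin (Δ + 1))) (S : Finset (Fin (Δ + 1))) (m : ℕ) :
    Finset (Fin (Δ + 1)) :=
  S.filter fun c => (S.filter fun d => p d < p c).card < m

/-- The degree of `u` in the subgraph induced on `H`. -/
def degIn (s : State V Δ) (H : Finset V) (u : V) : ℕ := (H.filter (s.graph.Adj u)).card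

/-- The tentative colors in the partial list-coloring of `H`: independent and uniform in the
palettes `C u`, `u ∈ H` (the value off `H` is a dummy). There is no proposal if a palette is
empty. -/
def propose (H : Finset V) (C : V → Finset (Fin (Δ + 1))) :
    PMF (Option (V → Fin (Δ + 1))) :=
  if h : (Fintype.piFinset fun u => if u ∈ H then C u else {0}).Nonempty then
    (PMF.uniformOfFinset _ h).map some
  else PMF.pure none

/-- The vertices of `H` whose tentative color was not proposed by any neighbor in `H`. -/
def winners (s : State V Δ) (H : Finset V) (f : V → Fin (Δ + 1)) : Finset V :=
  H.filter fun u => ∀ v ∈ H, s.graph.Adj u v → f v ≠ f u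

/-- Color the vertices of `L` by `f`, with new timestamps `t`. -/
def paint (L : Finset V) (f : V → Fin (Δ + 1)) (t : Time) (s : State V Δ) : State V Δ :=
  { s with
    color := fun v => if v ∈ L then some (f v) else s.color v
    time := fun v => if v ∈ L then t else s.time v
    hist := s.log }

/-- The lower neighbors whose color was chosen as a unique color by a vertex of `L`. -/
def displaced (s : State V Δ) (L : Finset V) (f : V → Fin (Δ + 1)) : Finset V :=
  Finset.univ.filter fun v => ∃ u ∈ L, s.lowerWith u (f u) = {v}

/-- One round of the coloring of marked vertices; the state of the loop is the list `H` of
uncolored vertices, their palettes, and the state of the algorithm. -/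
def colorMarkedRound (x : Finset V × (V → Finset (Fin (Δ + 1))) × State V Δ) :
    PMF (Finset V × (V → Finset (Fin (Δ + 1))) × State V Δ) :=
  (propose x.1 x.2.1).map fun o =>
    match o with
    | none => x
    | some f =>
      let L := winners x.2.2 x.1 f
      (x.1 \ L,
        (fun u => x.2.1 u \ (L.filter (x.2.2.graph.Adj u)).image f),
        paint L f ⊤ x.2.2)

/-- Color the marked vertices of level `i`, using blank colors only. -/
def colorMarked (arr : Arrangement V Δ) (i : ℕ) (s : State V Δ) : PMF (State V Δ) :=
  let H := s.mrkdU i ∪ s.mrkdL i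
  (whileLoop (fun x => x.1.Nonempty) colorMarkedRound
    (H, (fun u => firstOf (arr s u) (s.blank u) (degIn s H u + 1)), s)).map fun x => x.2.2

/-- One round of the coloring of the unmarked vertices of level `i` in batch `k`; the state of the
loop is the list `H` of uncolored vertices and the state of the algorithm. -/
def colorUnmarkedRound (b : ℕ) (arr : Arrangement V Δ) (k i : ℕ) (x : Finset V × State V Δ) :
    PMF (Finset V × State V Δ) :=
  (propose x.1 fun u => firstOf (arr x.2 u) (x.2.blank u ∪ x.2.unique u)
      (max (degIn x.2 x.1 u + 1) (3 ^ (i - 5) / 2 + 1))).map fun o =>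
    match o with
    | none => x
    | some f =>
      let L := winners x.2 x.1 f
      (x.1 \ L,
        State.uncolor b (displaced x.2 L f)
          (paint L f (((toLex (k, OrderDual.toDual i)) : ℕ ×ₗ ℕᵒᵈ) : Time) x.2))

/-- Color the unmarked vertices of level `i`, using blank or unique colors. -/
def colorUnmarked (b : ℕ) (arr : Arrangement V Δ) (k i : ℕ) (s : State V Δ) :
    PMF (State V Δ) :=
  (whileLoop (fun x => x.1.Nonempty) (colorUnmarkedRound b arr k i) (s.unmrkd i, s)).map
    fun x => x.2

/-- The coloring phase of batch `k`: from the top level down to the bottom level `b`, first color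
the marked and then the unmarked vertices. -/
def colorPhase (b : ℕ) (arr : Arrangement V Δ) (k : ℕ) : State V Δ → PMF (State V Δ) :=
  forLoop (fun i s => (colorMarked arr i s).bind (colorUnmarked b arr k i))
    (levelsDown b (topLevel Δ))

/-! ### Moving phase -/

/-- The condition under which `u` may be raised to level `k`. -/
def CanRaise (s : State V Δ) (k : ℕ) (u : V) : Prop :=
  3 ^ (k - 1) ≤ (s.below u (k - 1)).card ∧ (s.below u k).card ≤ 3 ^ k

/-- The vertices of `S` with at most `m` neighbors in `S`. -/
def sparse (s : State V Δ) (S : Finset V) (m : ℝ) : Finset V :=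
  S.filter fun u => (degIn s S u : ℝ) ≤ m

/-- One round of the raising procedure for level `k`; the state of the loop consists of `U⁺`, `U⁻`
and the state of the algorithm. -/
def raiseRound (k : ℕ) (x : Finset V × Finset V × State V Δ) :
    PMF (Finset V × Finset V × State V Δ) :=
  let U := x.1.filter (CanRaise x.2.2 k)
  (sample 24 U).map fun S =>
    let M := sparse x.2.2 S (3 ^ (k - 1) / 4)
    (U \ M, x.2.1 ∪ (x.1 \ U), x.2.2.moveTo M k)

/-- The raising procedure for level `k`: rounds until `U⁺` is empty, then `U⁺ ← U⁻`, `U⁻ ← ∅`. -/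
def raiseLevel (k : ℕ) (x : Finset V × Finset V × State V Δ) :
    PMF (Finset V × Finset V × State V Δ) :=
  (whileLoop (fun y => y.1.Nonempty) (raiseRound k) x).map fun y => (y.2.1, ∅, y.2.2)

/-- The raising procedure for the upper marked vertices of level `i`. -/
def raise (i : ℕ) (s : State V Δ) : PMF (State V Δ) :=
  (forLoop raiseLevel (levelsDown (i + 1) (topLevel Δ)) (s.mrkdU i, ∅, s)).map fun x => x.2.2

/-- The lowering procedure for the lower marked vertices of level `i`. -/
def lower (b i : ℕ) (s : State V Δ) : PMF (State V Δ) :=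
  (sample (2 * 3 ^ 6) (s.mrkdL i)).map fun S =>
    s.moveTo (sparse s S ((3 : ℝ) ^ ((i : ℤ) - 4))) (max b (i - 4))

/-- The moving phase: a raising pass from the top level down and a lowering pass from the bottom
level up. -/
def movePhase (b : ℕ) (s : State V Δ) : PMF (State V Δ) :=
  (forLoop raise (levelsDown b (topLevel Δ)) s).bind
    (forLoop (lower b) (levelsUp b (topLevel Δ)))

/-! ### The complete algorithm -/

/-- Extend the records at the end of a batch; `s` is the state after the coloring phase and `s'`
the state after the moving phase. A vertex is recolored at most once in a batch, and graph and
levels do not change in the coloring phase, so that `s` shows them at the time of recoloring. -/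
def closeBatch (b : ℕ) (s s' : State V Δ) : State V Δ :=
  { s' with
    record := fun u =>
      if u ∈ s.recolored then s.stamp b s' u :: s'.record u else s'.record u }

/-- The processing of batch number `k`. -/
def update (b : ℕ) (arr : Arrangement V Δ) (k : ℕ) (B : Batch V) (s : State V Δ) :
    PMF (State V Δ) :=
  (colorPhase b arr k (initPhase b B s)).bind fun s₁ => (movePhase b s₁).map (closeBatch b s₁)

/-- The processing of a list of batches, the first of which has number `k`. -/
def runFrom (b : ℕ) (arr : Arrangement V Δ) :
    ℕ → List (Batch V) → State V Δ → PMF (State V Δ)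
  | _, [], s => PMF.pure s
  | k, B :: l, s => (update b arr k B s).bind (runFrom b arr (k + 1) l)

/-- At the start the graph is empty, all vertices are on level `5`, and the colors are independent
and uniform. -/
def start (V : Type*) [Fintype V] [LinearOrder V] (Δ : ℕ) : PMF (State V Δ) :=
  (PMF.uniformOfFintype (V → Fin (Δ + 1))).map fun f =>
    { graph := ⊥
      level := fun _ => 5
      color := fun v => some (f v)
      time := fun _ => (((toLex (0, OrderDual.toDual 5)) : ℕ ×ₗ ℕᵒᵈ) : Time)
      mrkdU := fun _ => ∅
      mrkdL := fun _ => ∅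
      unmrkd := fun _ => ∅
      record := fun _ => []
      hist := [] }

/-- The law of the state after the batches `S`. -/
def run (b : ℕ) (arr : Arrangement V Δ) (S : List (Batch V)) : PMF (State V Δ) :=
  (start V Δ).bind (runFrom b arr 1 S)

end Algorithm

/-- The total cost of all dirty entries of the record. -/
def dirtyCost {V : Type*} [Fintype V] {Δ : ℕ} (s : State V Δ) : ℝ≥0∞ :=
  s.sumDirty Stamp.cost

/-- The movement cost of all dirty entries of the record. -/
def dirtyMoveCost {V : Type*} [Fintype V] {Δ : ℕ} (s : State V Δ) : ℝ≥0∞ :=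
  s.sumDirty Stamp.moveCost

end BatchColoring

end

noncomputable section

namespace BatchColoring

/-! ### Expectations -/

section Expectation

variable {σ τ : Type*}

/-! Graph and levels stay fixed during the coloring phase, so each batch can be analyzed
conditionally on the state `r` at the start of its moving phase. The dirty vertices recolored in the
batch are then exactly the upper and the lower marked ones. It suffices to compare their expected
cost with their expected movement cost over the moving phase alone; linearity of expectation adds up
the batches.

For upper marked vertices the comparison holds on every outcome. After the raising pass each of
them, now on level `ℓ'`, has at most `3 ^ ℓ'` neighbors up to that level (`raisePass_spec`). If `u`
reached its base level `d`, its cost is its movement cost. Otherwise at least two thirds of `3 ^ d`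
neighbors were raised past `u`. Let `u` charge one unit to each of them: a raised `v` is charged at
most `3 ^ ℓ'(v)` in total, which is its movement cost (`two_mul_cost_le`,
`sum_cost_upperMarked_le`).

A lower marked vertex of level `i` satisfies the upper condition, so it costs at most `9 * 3 ^ i`.
By Markov's inequality it is lowered with probability at least `1 / (4 * 3 ^ 6)`
(`le_expect_lowerPass`), and then pays `3 ^ i`. This gives the constant `9 * 4 * 3 ^ 6 = 26244`. -/

theorem expect_pure (s : σ) (X : σ → ℝ≥0∞) : expect (PMF.pure s) X = X s := by
  classical
  unfold expect
  rw [tsum_eq_single s fun t ht => by simp [ht]]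
  simp

theorem expect_bind (p : PMF σ) (f : σ → PMF τ) (X : τ → ℝ≥0∞) :
    expect (p.bind f) X = expect p fun s => expect (f s) X := by
  simp only [expect, PMF.bind_apply, ← ENNReal.tsum_mul_right, ← ENNReal.tsum_mul_left]
  rw [ENNReal.tsum_comm]
  simp only [mul_assoc]

theorem expect_map (p : PMF σ) (f : σ → τ) (X : τ → ℝ≥0∞) :
    expect (p.map f) X = expect p fun s => X (f s) := by
  rw [PMF.map, expect_bind]
  simp only [Function.comp, expect_pure]

theorem expect_mono {p : PMF σ} {X Y : σ → ℝ≥0∞} (h : ∀ s ∈ p.support, X s ≤ Y s) :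
    expect p X ≤ expect p Y := by
  refine ENNReal.tsum_le_tsum fun s => ?_
  by_cases hs : s ∈ p.support
  · gcongr
    exact h s hs
  · rw [PMF.mem_support_iff, not_not] at hs
    simp [hs]

theorem expect_congr {p : PMF σ} {X Y : σ → ℝ≥0∞} (h : ∀ s ∈ p.support, X s = Y s) :
    expect p X = expect p Y :=
  le_antisymm (expect_mono fun s hs => (h s hs).le) (expect_mono fun s hs => (h s hs).ge)

theorem expect_add (p : PMF σ) (X Y : σ → ℝ≥0∞) :
    (expect p fun s => X s + Y s) = expect p X + expect p Y := by
  simp only [expect, mul_add, ENNReal.tsum_add]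

theorem expect_const_mul (p : PMF σ) (c : ℝ≥0∞) (X : σ → ℝ≥0∞) :
    (expect p fun s => c * X s) = c * expect p X := by
  simp only [expect, ← ENNReal.tsum_mul_left, mul_left_comm]

theorem expect_const (p : PMF σ) (c : ℝ≥0∞) : (expect p fun _ => c) = c := by
  simp only [expect, ENNReal.tsum_mul_right, PMF.tsum_coe, one_mul]

theorem expect_finset_sum {ι : Type*} (p : PMF σ) (A : Finset ι) (X : ι → σ → ℝ≥0∞) :
    (expect p fun s => ∑ i ∈ A, X i s) = ∑ i ∈ A, expect p (X i) := by
  simp only [expect, Finset.mul_sum]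
  exact Summable.tsum_finsetSum fun i _ => ENNReal.summable

end Expectation

/-! ### Loops -/

section Loops

variable {σ : Type*} {c : σ → Prop} {f : σ → PMF σ} {P : σ → Prop}

theorem loopIter_invariant (hP : ∀ s, c s → P s → ∀ t ∈ (f s).support, P t) (n : ℕ) {s t : σ}
    (hs : P s) (ht : t ∈ (loopIter c f n s).support) : P t := by
  induction n generalizing s with
  | zero =>
    rw [loopIter, PMF.support_pure] at ht
    exact ht ▸ hs
  | succ n ih =>
    rw [loopIter] at ht
    split_ifs at ht with hc
    · obtain ⟨a, ha, hat⟩ := (PMF.mem_support_bind_iff _ _ _).1 ht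
      exact ih (hP s hc hs a ha) hat
    · rw [PMF.support_pure] at ht
      exact ht ▸ hs

theorem of_stopMass_ne_zero {n : ℕ} {s t : σ} (h : stopMass c f n s t ≠ 0) :
    ¬ c t ∧ t ∈ (loopIter c f n s).support := by
  unfold stopMass at h
  split_ifs at h with hc
  · exact absurd rfl h
  · exact ⟨hc, h⟩

/-- Any mass of runs that never stop sits on the starting state, which satisfies the invariant as
well. Hence invariants need no termination argument, and the coloring loops get none. -/
theorem whileLoop_invariant (hP : ∀ s, c s → P s → ∀ t ∈ (f s).support, P t) {s t : σ}
    (hs : P s) (ht : t ∈ (whileLoop c f s).support) : P t := by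
  classical
  by_cases hts : t = s
  · exact hts ▸ hs
  have h : (⨆ n, stopMass c f n s t) ≠ 0 := by
    intro h0
    refine (PMF.mem_support_iff _ _).1 ht ?_
    change (⨆ n, stopMass c f n s t) + _ = 0
    rw [h0, if_neg hts, add_zero]
  obtain ⟨n, hn⟩ : ∃ n, stopMass c f n s t ≠ 0 := by
    by_contra! h'
    exact h (by simp [h'])
  exact loopIter_invariant hP n hs (of_stopMass_ne_zero hn).2

/-- The probability that the loop stops. -/
def stopProb (c : σ → Prop) (f : σ → PMF σ) (s : σ) : ℝ≥0∞ :=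
  ⨆ n, ∑' t, stopMass c f n s t

/-! ### Almost sure termination -/

theorem stopProb_of_not {s : σ} (hs : ¬ c s) : stopProb c f s = 1 := by
  have h : ∀ n, ∑' t, stopMass c f n s t = 1 := by
    intro n
    have : ∀ t, stopMass c f n s t = PMF.pure s t := by
      intro t
      have hl : loopIter c f n s = PMF.pure s := by
        cases n with
        | zero => rfl
        | succ n => rw [loopIter, if_neg hs]
      unfold stopMass
      split_ifs with ht
      · have : t ≠ s := fun h => hs (h ▸ ht)
        simp [this]
      · rw [hl]
    simp only [this, PMF.tsum_coe]
  simp [stopProb, h]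

/-- Splitting off the first round relates `n + 1` rounds from `s` to `n` rounds from its successors;
monotone convergence gives the limit. -/
theorem expect_stopProb_le {s : σ} (hs : c s) :
    expect (f s) (stopProb c f) ≤ stopProb c f s := by
  have step : ∀ n, ∑' t, stopMass c f (n + 1) s t =
      ∑' a, f s a * ∑' t, stopMass c f n a t := by
    intro n
    simp only [← ENNReal.tsum_mul_left]
    rw [ENNReal.tsum_comm]
    refine tsum_congr fun t => ?_
    unfold stopMass
    split_ifs
    · simp
    · rw [loopIter, if_pos hs, PMF.bind_apply]
  have mono : ∀ a, Monotone fun n => f s a * ∑' t, stopMass c f n a t := fun a m n hmn => by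
    dsimp only
    gcongr with t
    exact stopMass_mono c f a t hmn
  unfold expect
  rw [ENNReal.tsum_eq_iSup_sum]
  refine iSup_le fun F => ?_
  calc ∑ a ∈ F, f s a * stopProb c f a
      = ∑ a ∈ F, ⨆ n, f s a * ∑' t, stopMass c f n a t := by
        simp only [stopProb, ENNReal.mul_iSup]
    _ = ⨆ n, ∑ a ∈ F, f s a * ∑' t, stopMass c f n a t :=
        ENNReal.finsetSum_iSup_of_monotone mono
    _ ≤ stopProb c f s := by
        refine iSup_le fun n => ?_
        refine (ENNReal.sum_le_tsum F).trans ?_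
        rw [← step]
        exact le_iSup (fun n => ∑' t, stopMass c f n s t) (n + 1)

theorem stopProb_le_one (s : σ) : stopProb c f s ≤ 1 := by
  refine iSup_le fun n => le_trans ?_ (tsum_stopMass_le_one c f s)
  exact ENNReal.tsum_le_tsum fun t => le_iSup (fun n => stopMass c f n s t) n

/-- A loop stops almost surely if a natural number that never increases decreases in each round
with a probability that is bounded away from zero. -/
theorem stopProb_eq_one (hP : ∀ s, c s → P s → ∀ t ∈ (f s).support, P t) (μ : σ → ℕ) {ε : ℝ≥0∞}
    (hε : ε ≠ 0) (hμ : ∀ s, c s → P s → ∀ t ∈ (f s).support, μ t ≤ μ s)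
    (hdec : ∀ s, c s → P s → ∃ t, μ t < μ s ∧ ε ≤ f s t) {s : σ} (hs : P s) :
    stopProb c f s = 1 := by
  classical
  suffices H : ∀ m, ∀ s, P s → μ s < m → 1 ≤ stopProb c f s from
    le_antisymm (stopProb_le_one s) (H _ s hs (Nat.lt_succ_self _))
  intro m
  induction m with
  | zero => intro s _ h; exact absurd h (Nat.not_lt_zero _)
  | succ m ih =>
    -- `I` is the worst stopping probability for measure at most `m`. One round reaches measure
    -- below `m`, where stopping is certain by induction, with probability at least `ε`, and
    -- otherwise does no worse than `I`. So `I + (1 - I) * min ε 1 ≤ I`, which is impossible for `I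
    -- < 1`. The minimum with `1` covers states where the loop has already stopped.
    set I : ℝ≥0∞ := ⨅ s : {s // P s ∧ μ s < m + 1}, stopProb c f s with hI
    have hle : ∀ s, P s → μ s < m + 1 → I ≤ stopProb c f s := fun s h1 h2 =>
      iInf_le (fun s : {s // P s ∧ μ s < m + 1} => stopProb c f s) ⟨s, h1, h2⟩
    suffices h1 : 1 ≤ I from fun s h2 h3 => h1.trans (hle s h2 h3)
    by_contra hlt
    rw [not_le] at hlt
    have hfin : I ≠ ⊤ := (hlt.trans ENNReal.one_lt_top).ne
    have key : I + (1 - I) * min ε 1 ≤ I := by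
      conv_rhs => rw [hI]
      refine le_iInf fun ⟨s, hPs, hms⟩ => ?_
      by_cases hc : c s
      · refine le_trans ?_ (expect_stopProb_le hc)
        obtain ⟨t, ht, hεt⟩ := hdec s hc hPs
        calc I + (1 - I) * min ε 1 ≤ I + (1 - I) * f s t := by
              gcongr
              exact (min_le_left _ _).trans hεt
          _ = expect (f s) fun a => I + (1 - I) * if a = t then 1 else 0 := by
              rw [expect_add, expect_const, expect_const_mul]
              simp [expect]
          _ ≤ expect (f s) (stopProb c f) := by
              refine expect_mono fun a ha => ?_
              by_cases hat : a = t
              · subst hat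
                simp only [if_true, mul_one]
                rw [add_tsub_cancel_of_le hlt.le]
                exact ih a (hP s hc hPs a ha) (by omega)
              · simp only [hat, if_false, mul_zero, add_zero]
                exact hle a (hP s hc hPs a ha) ((hμ s hc hPs a ha).trans_lt hms)
      · rw [stopProb_of_not hc]
        calc I + (1 - I) * min ε 1 ≤ I + (1 - I) * 1 := by
              gcongr
              exact min_le_right _ _
          _ = 1 := by rw [mul_one, add_tsub_cancel_of_le hlt.le]
    have h0 : (1 - I) * min ε 1 ≠ 0 :=
      mul_ne_zero (tsub_pos_of_lt hlt).ne' (lt_min (pos_iff_ne_zero.2 hε) one_pos).ne'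
    exact absurd key (not_le.2 (ENNReal.lt_add_right hfin h0))

theorem whileLoop_not_of_stopProb {s t : σ} (hs : stopProb c f s = 1)
    (ht : t ∈ (whileLoop c f s).support) : ¬ c t := by
  classical
  have h1 : (1 : ℝ≥0∞) - ∑' r, ⨆ n, stopMass c f n s r = 0 := by
    rw [tsub_eq_zero_iff_le, ← hs]
    exact iSup_le fun n => ENNReal.tsum_le_tsum fun t => le_iSup (fun n => stopMass c f n s t) n
  have h : (⨆ n, stopMass c f n s t) ≠ 0 := by
    intro h0
    refine (PMF.mem_support_iff _ _).1 ht ?_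
    change (⨆ n, stopMass c f n s t) + _ = 0
    rw [h0, h1, ite_self, add_zero]
  obtain ⟨n, hn⟩ : ∃ n, stopMass c f n s t ≠ 0 := by
    by_contra! h'
    exact h (by simp [h'])
  exact (of_stopMass_ne_zero hn).1

/-! ### Loops over levels -/

theorem forLoop_invariant {f : ℕ → σ → PMF σ} {l : List ℕ}
    (hP : ∀ i ∈ l, ∀ s, P s → ∀ t ∈ (f i s).support, P t) {s t : σ} (hs : P s)
    (ht : t ∈ (forLoop f l s).support) : P t := by
  induction l generalizing s with
  | nil =>
    rw [forLoop, PMF.support_pure] at ht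
    exact ht ▸ hs
  | cons i l ih =>
    obtain ⟨a, ha, hat⟩ := (PMF.mem_support_bind_iff _ _ _).1 ht
    exact ih (fun j hj => hP j (List.mem_cons_of_mem _ hj))
      (hP i List.mem_cons_self s hs a ha) hat

theorem mem_levelsUp {a n i : ℕ} : i ∈ levelsUp a n ↔ a ≤ i ∧ i ≤ n := by
  rw [levelsUp, List.mem_range'_1]
  omega

theorem levelsDown_succ {a n : ℕ} (h : a ≤ n + 1) :
    levelsDown a (n + 1) = (n + 1) :: levelsDown a n := by
  unfold levelsDown levelsUp
  rw [show n + 1 + 1 - a = (n + 1 - a) + 1 by omega, List.range'_concat, List.reverse_append]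
  simp
  omega

/-- An invariant that depends on the loop variable, for a loop that counts down to `a + 1`. -/
theorem forLoop_levelsDown {f : ℕ → σ → PMF σ} {Q : ℕ → σ → Prop} {a n : ℕ} (han : a ≤ n)
    (hQ : ∀ k, a < k → k ≤ n → ∀ s, Q k s → ∀ t ∈ (f k s).support, Q (k - 1) t) {s t : σ}
    (hs : Q n s) (ht : t ∈ (forLoop f (levelsDown (a + 1) n) s).support) : Q a t := by
  induction n, han using Nat.le_induction generalizing s with
  | base =>
    rw [levelsDown, levelsUp, Nat.sub_self, List.range'_zero, List.reverse_nil, forLoop,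
      PMF.support_pure] at ht
    exact ht ▸ hs
  | succ n han ih =>
    rw [levelsDown_succ (by omega)] at ht
    obtain ⟨u, hu, hut⟩ := (PMF.mem_support_bind_iff _ _ _).1 ht
    exact ih (fun k h1 h2 => hQ k h1 (by omega)) (hQ (n + 1) (by omega) le_rfl s hs u hu) hut

end Loops

set_option linter.unusedSectionVars false

open scoped Classical

variable {V : Type*} [Fintype V] [LinearOrder V] {Δ : ℕ}

/-! ### Neighborhoods and correct markings -/

namespace State

theorem mem_below {s : State V Δ} {u v : V} {j : ℕ} :
    v ∈ s.below u j ↔ s.graph.Adj u v ∧ s.level v ≤ j := by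
  simp [below]

/-- Raising can only push neighbors out of `N_u(1, j)`, so upper bounds on these sets survive the
whole raising pass. -/
theorem below_subset {s s' : State V Δ} (hg : s'.graph = s.graph)
    (hl : ∀ v, s.level v ≤ s'.level v) (u : V) (j : ℕ) : s'.below u j ⊆ s.below u j := by
  intro v hv
  rw [mem_below, hg] at hv
  exact mem_below.2 ⟨hv.1, (hl v).trans hv.2⟩

end State

open State

/-- The entries of the tables are classified correctly. -/
structure WellMarked (b : ℕ) (s : State V Δ) : Prop where
  upper : ∀ i, ∀ u ∈ s.mrkdU i, s.level u = i ∧ ¬ s.Upper u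
  lower : ∀ i, ∀ u ∈ s.mrkdL i, s.level u = i ∧ s.Upper u ∧ ¬ s.Lower b u
  clean : ∀ i, ∀ u ∈ s.unmrkd i, s.level u = i ∧ s.Clean b u

theorem WellMarked.of_uncolor {b : ℕ} {s : State V Δ} (h : WellMarked b s) (A : Finset V) :
    WellMarked b (s.uncolor b A) where
  upper i u hu := by
    rcases Finset.mem_union.1 hu with hu | hu
    · exact h.upper i u hu
    · exact (Finset.mem_filter.1 hu).2
  lower i u hu := by
    rcases Finset.mem_union.1 hu with hu | hu
    · exact h.lower i u hu
    · exact (Finset.mem_filter.1 hu).2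
  clean i u hu := by
    rcases Finset.mem_union.1 hu with hu | hu
    · exact h.clean i u hu
    · exact (Finset.mem_filter.1 hu).2

/-- The state `s` arises from `r` by changes of colors and correctly classified markings only. -/
structure Recolored (b : ℕ) (r s : State V Δ) : Prop where
  graph : s.graph = r.graph
  level : s.level = r.level
  record : s.record = r.record
  marked : WellMarked b s

/-! ### The coloring phase -/

theorem Recolored.of_paint {b : ℕ} {r s : State V Δ} (h : Recolored b r s) (L : Finset V)
    (f : V → Fin (Δ + 1)) (t : Time) : Recolored b r (paint L f t s) :=
  ⟨h.graph, h.level, h.record, h.marked.upper, h.marked.lower, h.marked.clean⟩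

theorem Recolored.of_uncolor {b : ℕ} {r s : State V Δ} (h : Recolored b r s) (A : Finset V) :
    Recolored b r (s.uncolor b A) :=
  ⟨h.graph, h.level, h.record, h.marked.of_uncolor A⟩

theorem recolored_initPhase (b : ℕ) (B : Batch V) (s : State V Δ) :
    Recolored b (initPhase b B s) (initPhase b B s) := by
  refine ⟨rfl, rfl, rfl, ?_⟩
  refine WellMarked.of_uncolor ⟨?_, ?_, ?_⟩ _ <;> intro i u hu <;> simp at hu

theorem Recolored.of_mem_colorMarked {b i : ℕ} {arr : Arrangement V Δ} {r s t : State V Δ}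
    (h : Recolored b r s) (ht : t ∈ (colorMarked arr i s).support) : Recolored b r t := by
  obtain ⟨x, hx, rfl⟩ := (PMF.mem_support_map_iff _ _ _).1 ht
  refine whileLoop_invariant (P := fun x => Recolored b r x.2.2) ?_ ?_ hx
  · intro x _ hx y hy
    obtain ⟨o, -, rfl⟩ := (PMF.mem_support_map_iff _ _ _).1 hy
    cases o with
    | none => exact hx
    | some f => exact Recolored.of_paint hx _ _ _
  · exact h

theorem Recolored.of_mem_colorUnmarked {b k i : ℕ} {arr : Arrangement V Δ} {r s t : State V Δ}
    (h : Recolored b r s) (ht : t ∈ (colorUnmarked b arr k i s).support) : Recolored b r t := by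
  obtain ⟨x, hx, rfl⟩ := (PMF.mem_support_map_iff _ _ _).1 ht
  refine whileLoop_invariant (P := fun x => Recolored b r x.2) ?_ ?_ hx
  · intro x _ hx y hy
    obtain ⟨o, -, rfl⟩ := (PMF.mem_support_map_iff _ _ _).1 hy
    cases o with
    | none => exact hx
    | some f => exact Recolored.of_uncolor (Recolored.of_paint hx _ _ _) _
  · exact h

theorem Recolored.of_mem_colorPhase {b k : ℕ} {arr : Arrangement V Δ} {r s t : State V Δ}
    (h : Recolored b r s) (ht : t ∈ (colorPhase b arr k s).support) : Recolored b r t := by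
  refine forLoop_invariant (P := Recolored b r) ?_ h ht
  intro i _ s hs t ht
  obtain ⟨a, ha, hat⟩ := (PMF.mem_support_bind_iff _ _ _).1 ht
  exact (hs.of_mem_colorMarked ha).of_mem_colorUnmarked hat

/-! ### Sampling and moving -/

theorem sample_support_subset {n : ℕ} [NeZero n] {U S : Finset V}
    (hS : S ∈ (sample n U).support) : S ⊆ U := by
  obtain ⟨f, -, rfl⟩ := (PMF.mem_support_map_iff _ _ _).1 hS
  exact Finset.filter_subset _ _

theorem le_map_apply {α β : Type*} (p : PMF α) (f : α → β) (a : α) : p a ≤ p.map f (f a) := by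
  rw [PMF.map_apply]
  refine le_trans ?_ (ENNReal.le_tsum a)
  simp

/-- One function suffices as witness: `0` at `u` and `1` elsewhere. What matters is that the bound
does not depend on `U`. -/
theorem le_sample_singleton {n : ℕ} (hn : 1 < n) [NeZero n] {U : Finset V} {u : V}
    (hu : u ∈ U) : ((Fintype.card (V → Fin n) : ℝ≥0∞))⁻¹ ≤ sample n U {u} := by
  have h01 : (⟨1, hn⟩ : Fin n) ≠ 0 := by
    intro h
    simpa using congrArg Fin.val h
  have h := le_map_apply (PMF.uniformOfFintype (V → Fin n)) (fun f => U.filter fun u => f u = 0)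
    (fun v => if v = u then 0 else ⟨1, hn⟩)
  rw [PMF.uniformOfFintype_apply] at h
  have hS : (U.filter fun v => (if v = u then (0 : Fin n) else ⟨1, hn⟩) = 0) = {u} := by
    ext v
    by_cases hv : v = u <;> simp [hv, hu, h01]
  simp only [hS] at h
  exact h

/-- `s` arises from `r` by moving upper marked vertices to higher levels. -/
structure Raised (r s : State V Δ) : Prop where
  graph : s.graph = r.graph
  mrkdU : s.mrkdU = r.mrkdU
  mrkdL : s.mrkdL = r.mrkdL
  record : s.record = r.record
  le : ∀ v, r.level v ≤ s.level v
  top : ∀ v, s.level v ≤ topLevel Δ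
  moved : ∀ v, s.level v ≠ r.level v → ∃ i, v ∈ r.mrkdU i

/-- The vertex `u` has at most `3 ^ j` neighbors up to its level `j`. -/
def Settled (s : State V Δ) (u : V) : Prop := (s.below u (s.level u)).card ≤ 3 ^ s.level u

/-- The invariant of the raising procedure for level `i` at target level `k`. -/
structure RaiseInv (r : State V Δ) (i k : ℕ) (x : Finset V × Finset V × State V Δ) : Prop where
  raised : Raised r x.2.2
  plus : x.1 ⊆ r.mrkdU i
  disj : Disjoint x.1 x.2.1
  low : ∀ j < i, ∀ u ∈ r.mrkdU j, x.2.2.level u = j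
  high : ∀ j > i, ∀ u ∈ r.mrkdU j, Settled x.2.2 u
  settled : ∀ u ∈ r.mrkdU i, u ∉ x.1 → u ∉ x.2.1 → Settled x.2.2 u
  here : ∀ u, u ∈ x.1 ∨ u ∈ x.2.1 → u ∈ r.mrkdU i ∧ x.2.2.level u = i
  plus_card : ∀ u ∈ x.1, (x.2.2.below u k).card ≤ 3 ^ k
  minus_card : ∀ u ∈ x.2.1, (x.2.2.below u (k - 1)).card ≤ 3 ^ (k - 1)

/-! ### Neighborhood bounds through the raising pass -/

theorem Raised.moveTo {r s : State V Δ} (h : Raised r s) {M : Finset V} {i k : ℕ}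
    (hM : M ⊆ r.mrkdU i) (hl : ∀ u ∈ M, s.level u ≤ k) (hk : k ≤ topLevel Δ) :
    Raised r (s.moveTo M k) where
  graph := h.graph
  mrkdU := h.mrkdU
  mrkdL := h.mrkdL
  record := h.record
  le v := by
    change r.level v ≤ if v ∈ M then k else s.level v
    split_ifs with hv
    · exact (h.le v).trans (hl v hv)
    · exact h.le v
  top v := by
    change (if v ∈ M then k else s.level v) ≤ _
    split_ifs with hv
    · exact hk
    · exact h.top v
  moved v := by
    change (if v ∈ M then k else s.level v) ≠ _ → _
    split_ifs with hv
    · exact fun _ => ⟨i, hM hv⟩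
    · exact h.moved v

/-- Levels only rise, so all cardinality bounds persist. A vertex moved now is settled by
`plus_card`. A vertex discarded now satisfies the bound at `k`, so it must have failed the first
half of `CanRaise`; that failure is the bound at `k - 1` demanded by `minus_card`. -/
theorem RaiseInv.round {r : State V Δ} {b i k : ℕ} (hr : WellMarked b r) (hik : i < k)
    (hk : k ≤ topLevel Δ) {x y : Finset V × Finset V × State V Δ} (hx : RaiseInv r i k x)
    (hy : y ∈ (raiseRound k x).support) : RaiseInv r i k y ∧ y.1 ⊆ x.1 := by
  obtain ⟨S, hS, rfl⟩ := (PMF.mem_support_map_iff _ _ _).1 hy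
  set U := x.1.filter (CanRaise x.2.2 k) with hU
  have hSU : S ⊆ U := sample_support_subset hS
  set M := sparse x.2.2 S (3 ^ (k - 1) / 4) with hM
  have hMU : M ⊆ U := (Finset.filter_subset _ _).trans hSU
  have hUx : U ⊆ x.1 := Finset.filter_subset _ _
  have hMi : M ⊆ r.mrkdU i := (hMU.trans hUx).trans hx.plus
  have hlev : ∀ u ∈ M, x.2.2.level u ≤ k := fun u hu => by
    rw [(hx.here u (Or.inl (hUx (hMU hu)))).2]
    exact hik.le
  set s' := x.2.2.moveTo M k with hs'
  have hle : ∀ v, x.2.2.level v ≤ s'.level v := fun v => by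
    change _ ≤ if v ∈ M then k else x.2.2.level v
    split_ifs with hv
    · exact hlev v hv
    · exact le_rfl
  have hcard : ∀ u j, (s'.below u j).card ≤ (x.2.2.below u j).card := fun u j =>
    Finset.card_le_card (below_subset (s := x.2.2) (s' := s') rfl hle u j)
  have hin : ∀ u ∈ M, s'.level u = k := fun u hu => if_pos hu
  have hout : ∀ u ∉ M, s'.level u = x.2.2.level u := fun u hu => if_neg hu
  have hset : ∀ u ∉ M, Settled x.2.2 u → Settled s' u := fun u hu h => by
    unfold Settled
    rw [hout u hu]
    exact (hcard _ _).trans h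
  have hother : ∀ j, j ≠ i → ∀ u ∈ r.mrkdU j, u ∉ M := fun j hj u hu huM =>
    hj ((hr.upper j u hu).1.symm.trans (hr.upper i u (hMi huM)).1)
  have hdisj := Finset.disjoint_left.1 hx.disj
  refine ⟨⟨hx.raised.moveTo hMi hlev hk, ?_, ?_, ?_, ?_, ?_, ?_, ?_, ?_⟩, ?_⟩
  · exact (Finset.sdiff_subset.trans hUx).trans hx.plus
  · rw [Finset.disjoint_left]
    intro u hu hu'
    have h1 := Finset.mem_sdiff.1 hu
    rcases Finset.mem_union.1 hu' with h | h
    · exact hdisj (hUx h1.1) h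
    · exact (Finset.mem_sdiff.1 h).2 h1.1
  · intro j hj u hu
    exact (hout u (hother j hj.ne u hu)).trans (hx.low j hj u hu)
  · intro j hj u hu
    exact hset u (hother j (ne_of_gt hj) u hu) (hx.high j hj u hu)
  · intro u hu h1 h2
    simp only [Finset.mem_sdiff, Finset.mem_union, not_and, not_not, not_or] at h1 h2
    by_cases huM : u ∈ M
    · change (s'.below u (s'.level u)).card ≤ 3 ^ s'.level u
      rw [hin u huM]
      exact (hcard _ _).trans (hx.plus_card u (hUx (hMU huM)))
    · have h3 : u ∉ x.1 := fun h => huM (h1 (h2.2 h))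
      exact hset u huM (hx.settled u hu h3 h2.1)
  · intro u hu
    have huM : u ∉ M := by
      intro huM
      rcases hu with h | h
      · exact (Finset.mem_sdiff.1 h).2 huM
      · rcases Finset.mem_union.1 h with h | h
        · exact hdisj (hUx (hMU huM)) h
        · exact (Finset.mem_sdiff.1 h).2 (hMU huM)
    have : u ∈ x.1 ∨ u ∈ x.2.1 := by
      rcases hu with h | h
      · exact Or.inl (hUx (Finset.mem_sdiff.1 h).1)
      · rcases Finset.mem_union.1 h with h | h
        · exact Or.inr h
        · exact Or.inl (Finset.mem_sdiff.1 h).1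
    exact ⟨(hx.here u this).1, (hout u huM).trans (hx.here u this).2⟩
  · intro u hu
    exact (hcard _ _).trans (hx.plus_card u (hUx (Finset.mem_sdiff.1 hu).1))
  · intro u hu
    refine (hcard _ _).trans ?_
    rcases Finset.mem_union.1 hu with h | h
    · exact hx.minus_card u h
    · obtain ⟨h1, h2⟩ := Finset.mem_sdiff.1 h
      by_contra! h3
      exact h2 (Finset.mem_filter.2 ⟨h1, h3.le, hx.plus_card u h1⟩)
  · exact Finset.sdiff_subset.trans hUx

/-- Either nobody qualifies and all of `U⁺` is discarded, or some candidate may be sampled alone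
and, having no sampled neighbor, is moved. The probability bound is uniform over states, as
`stopProb_eq_one` requires. -/
theorem exists_raiseRound_lt {k : ℕ} {x : Finset V × Finset V × State V Δ} (hx : x.1.Nonempty) :
    ∃ y, y.1.card < x.1.card ∧ ((Fintype.card (V → Fin 24) : ℝ≥0∞))⁻¹ ≤ raiseRound k x y := by
  set U := x.1.filter (CanRaise x.2.2 k) with hU
  have hUx : U ⊆ x.1 := Finset.filter_subset _ _
  rcases U.eq_empty_or_nonempty with h0 | ⟨u, hu⟩
  · refine ⟨_, ?_, le_trans ?_ (le_map_apply _ _ ∅)⟩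
    · change ((x.1.filter (CanRaise x.2.2 k)) \ _).card < _
      rw [← hU, h0, Finset.empty_sdiff]
      exact hx.card_pos
    · change _ ≤ sample 24 U ∅
      rw [h0]
      have h := le_map_apply (PMF.uniformOfFintype (V → Fin 24))
        (fun f => (∅ : Finset V).filter fun u => f u = 0) (fun _ => 0)
      rwa [PMF.uniformOfFintype_apply, Finset.filter_empty] at h
  · refine ⟨_, ?_, le_trans (le_sample_singleton (by norm_num) hu) (le_map_apply _ _ {u})⟩
    refine Finset.card_lt_card ((Finset.ssubset_iff_of_subset
      (Finset.sdiff_subset.trans hUx)).2 ⟨u, hUx hu, ?_⟩)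
    intro h
    refine (Finset.mem_sdiff.1 h).2 (Finset.mem_filter.2 ⟨Finset.mem_singleton_self u, ?_⟩)
    have : degIn x.2.2 {u} u = 0 := by
      simp [degIn, Finset.filter_singleton]
    rw [this, Nat.cast_zero]
    positivity

/-- Here termination is essential: once `U⁺` is exhausted, only the discarded vertices remain, and
their `minus_card` is the `plus_card` of target level `k - 1`. -/
theorem RaiseInv.level {r : State V Δ} {b i k : ℕ} (hr : WellMarked b r) (hik : i < k)
    (hk : k ≤ topLevel Δ) {x y : Finset V × Finset V × State V Δ} (hx : RaiseInv r i k x)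
    (hy : y ∈ (raiseLevel k x).support) : RaiseInv r i (k - 1) y ∧ y.2.1 = ∅ := by
  obtain ⟨z, hz, rfl⟩ := (PMF.mem_support_map_iff _ _ _).1 hy
  have hpres : ∀ s : Finset V × Finset V × State V Δ, s.1.Nonempty → RaiseInv r i k s →
      ∀ t ∈ (raiseRound k s).support, RaiseInv r i k t :=
    fun s _ hs t ht => (hs.round hr hik hk ht).1
  have hzI : RaiseInv r i k z := whileLoop_invariant hpres hx hz
  have hprob : stopProb (fun y : Finset V × Finset V × State V Δ => y.1.Nonempty)
      (raiseRound k) x = 1 :=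
    stopProb_eq_one hpres (fun y => y.1.card)
      (ENNReal.inv_ne_zero.2 (ENNReal.natCast_ne_top (Fintype.card (V → Fin 24))))
      (fun s _ hs t ht => Finset.card_le_card (hs.round hr hik hk ht).2)
      (fun s hs _ => exists_raiseRound_lt hs) hx
  have hz0 : z.1 = ∅ := Finset.not_nonempty_iff_eq_empty.1
    (whileLoop_not_of_stopProb (c := fun y : Finset V × Finset V × State V Δ => y.1.Nonempty)
      hprob hz)
  refine ⟨⟨hzI.raised, ?_, ?_, hzI.low, hzI.high, ?_, ?_, hzI.minus_card, ?_⟩, rfl⟩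
  · exact fun u hu => (hzI.here u (Or.inr hu)).1
  · exact Finset.disjoint_empty_right _
  · exact fun u hu h _ => hzI.settled u hu (by simp [hz0]) h
  · intro u hu
    rcases hu with h | h
    · exact hzI.here u (Or.inr h)
    · simp at h
  · intro u hu
    simp at hu

/-- The state of the raising pass before level `i` is processed. -/
structure PassInv (r : State V Δ) (i : ℕ) (s : State V Δ) : Prop where
  raised : Raised r s
  low : ∀ j ≤ i, ∀ u ∈ r.mrkdU j, s.level u = j
  high : ∀ j > i, ∀ u ∈ r.mrkdU j, Settled s u

theorem PassInv.raise {r s t : State V Δ} {b i : ℕ} (hr : WellMarked b r) (hi : 0 < i)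
    (hit : i ≤ topLevel Δ)
    (hdeg : ∀ u j, (r.below u j).card ≤ 3 ^ topLevel Δ) (hs : PassInv r i s)
    (ht : t ∈ (raise i s).support) : PassInv r (i - 1) t := by
  obtain ⟨x, hx, rfl⟩ := (PMF.mem_support_map_iff _ _ _).1 ht
  have h0 : RaiseInv r i (topLevel Δ) (s.mrkdU i, ∅, s) := by
    refine ⟨hs.raised, ?_, Finset.disjoint_empty_right _, fun j hj => hs.low j hj.le, hs.high,
      ?_, ?_, ?_, ?_⟩
    · rw [hs.raised.mrkdU]
    · intro u hu h
      rw [hs.raised.mrkdU] at h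
      exact absurd hu h
    · intro u hu
      simp only [Finset.notMem_empty, or_false, hs.raised.mrkdU] at hu
      exact ⟨hu, hs.low i le_rfl u hu⟩
    -- The bound holds initially at the top level because degrees are at most `3 ^ topLevel Δ`.
    · intro u _
      exact (Finset.card_le_card (below_subset hs.raised.graph hs.raised.le u _)).trans (hdeg u _)
    · intro u hu
      simp at hu
  obtain ⟨h1, h2⟩ := forLoop_levelsDown (Q := fun k x => RaiseInv r i k x ∧ x.2.1 = ∅) hit
    (fun k h1 h2 x hx y hy => hx.1.level hr h1 h2 hy) ⟨h0, rfl⟩ hx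
  refine ⟨h1.raised, fun j hj => h1.low j (by omega), fun j hj u hu => ?_⟩
  rcases Nat.eq_or_lt_of_le (show i ≤ j by omega) with rfl | hij
  -- A vertex never moved stays on level `i` and carries the bound for `k = i`, so it is settled
  -- where it stands.
  · by_cases hu1 : u ∈ x.1
    · have := h1.plus_card u hu1
      unfold Settled
      rwa [(h1.here u (Or.inl hu1)).2]
    · exact h1.settled u hu hu1 (by simp [h2])
  · exact h1.high j hij u hu

/-- The effect of the raising pass. -/
theorem raisePass_spec {r t : State V Δ} {b : ℕ} (hb : 1 ≤ b) (hbt : b ≤ topLevel Δ + 1)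
    (hr : WellMarked b r) (hlev : ∀ v, b ≤ r.level v ∧ r.level v ≤ topLevel Δ)
    (hdeg : ∀ u j, (r.below u j).card ≤ 3 ^ topLevel Δ)
    (ht : t ∈ (forLoop raise (levelsDown b (topLevel Δ)) r).support) :
    Raised r t ∧ ∀ i, ∀ u ∈ r.mrkdU i, Settled t u := by
  -- The descending invariant ends one level below `b`, so that level `b` itself counts as
  -- processed.
  obtain ⟨a, rfl⟩ : ∃ a, b = a + 1 := ⟨b - 1, by omega⟩
  have h0 : PassInv r (topLevel Δ) r := by
    refine ⟨⟨rfl, rfl, rfl, rfl, fun _ => le_rfl, fun v => (hlev v).2, fun v h => absurd rfl h⟩,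
      fun j _ u hu => (hr.upper j u hu).1, fun j hj u hu => ?_⟩
    have h1 := (hr.upper j u hu).1
    have h2 := (hlev u).2
    omega
  have h := forLoop_levelsDown (Q := PassInv r) (by omega : a ≤ topLevel Δ)
    (fun k h1 h2 x hx y hy => hx.raise hr (by omega) h2 hdeg hy) h0 ht
  refine ⟨h.raised, fun i u hu => h.high i ?_ u hu⟩
  have h1 := (hr.upper i u hu).1
  have h2 := (hlev u).1
  omega

/-! ### The lowering procedure -/

/-- Independence in counting form: all of `W` is sampled with probability `n ^ (-|W|)`. It is used
for one vertex and for a pair. -/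
theorem card_filter_eq_zero_mul (n : ℕ) [NeZero n] (W : Finset V) :
    (Finset.univ.filter fun f : V → Fin n => ∀ w ∈ W, f w = 0).card * n ^ W.card =
      n ^ Fintype.card V := by
  have h : (Finset.univ.filter fun f : V → Fin n => ∀ w ∈ W, f w = 0) =
      Fintype.piFinset fun w => if w ∈ W then {0} else Finset.univ := by
    ext f
    simp only [Finset.mem_filter, Finset.mem_univ, true_and, Fintype.mem_piFinset]
    refine forall_congr' fun w => ?_
    by_cases hw : w ∈ W <;> simp [hw]
  have h2 : n ^ W.card = ∏ w : V, if w ∈ W then n else 1 := by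
    rw [Finset.prod_ite_mem, Finset.univ_inter, Finset.prod_const]
  rw [h, Fintype.card_piFinset, h2, ← Finset.prod_mul_distrib, ← Finset.card_univ,
    ← Finset.prod_const]
  refine Finset.prod_congr rfl fun w _ => ?_
  by_cases hw : w ∈ W <;> simp [hw]

/-- A vertex with few neighbors in `U` is sampled together with few neighbors with probability at
least `1 / (2 * n)`. -/
theorem le_expect_mem_sparse {n : ℕ} [NeZero n] (s : State V Δ) {U : Finset V} {u : V}
    (hu : u ∈ U) {m : ℝ} (hm : 0 < m) (hdeg : 2 * (degIn s U u : ℝ) ≤ n * m) :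
    ((2 * n : ℕ) : ℝ≥0∞)⁻¹ ≤
      expect (sample n U) fun S => if u ∈ sparse s S m then 1 else 0 := by
  have hn : (0 : ℝ) < n := Nat.cast_pos.2 (NeZero.pos n)
  set F : (V → Fin n) → Finset V := fun f => U.filter fun u => f u = 0 with hF
  set T : ℝ := (n : ℝ) ^ Fintype.card V with hT
  have hTpos : 0 < T := by positivity
  set A := Finset.univ.filter fun f : V → Fin n => f u = 0 with hA
  set B : V → Finset (V → Fin n) := fun v =>
    Finset.univ.filter fun f : V → Fin n => f u = 0 ∧ f v = 0 with hB
  set Good := Finset.univ.filter fun f : V → Fin n => u ∈ sparse s (F f) m with hGood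
  set N := U.filter (s.graph.Adj u) with hN
  have hAc : (A.card : ℝ) * n = T := by
    have h := card_filter_eq_zero_mul n ({u} : Finset V)
    simp only [Finset.mem_singleton, forall_eq, Finset.card_singleton, pow_one] at h
    rw [hT, hA]
    exact_mod_cast h
  have hBc : ∀ v ∈ N, ((B v).card : ℝ) * n ^ 2 = T := by
    intro v hv
    have huv : u ≠ v := (Finset.mem_filter.1 hv).2.ne
    have h := card_filter_eq_zero_mul n ({u, v} : Finset V)
    simp only [Finset.mem_insert, Finset.mem_singleton, forall_eq_or_imp, forall_eq,
      Finset.card_pair huv] at h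
    simp only [hT, hB]
    exact_mod_cast h
  -- Markov's inequality by counting: if `u` is sampled but not sparse, more than `m` of its
  -- neighbors are sampled together with it.
  have hcount : m * (A.card : ℝ) ≤ m * Good.card + ∑ v ∈ N, ((B v).card : ℝ) := by
    have hpt : ∀ f : V → Fin n, (m * if f u = 0 then (1 : ℝ) else 0) ≤
        (m * if u ∈ sparse s (F f) m then (1 : ℝ) else 0) +
          ∑ v ∈ N, if f u = 0 ∧ f v = 0 then (1 : ℝ) else 0 := by
      intro f
      have hsum : (0 : ℝ) ≤ ∑ v ∈ N, if f u = 0 ∧ f v = 0 then (1 : ℝ) else 0 :=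
        Finset.sum_nonneg fun v _ => by split_ifs <;> norm_num
      by_cases h0 : f u = 0
      · by_cases hs : u ∈ sparse s (F f) m
        · simp only [h0, hs, if_true]
          simp only [h0] at hsum
          linarith
        · have huF : u ∈ F f := Finset.mem_filter.2 ⟨hu, h0⟩
          have hlt : m < (degIn s (F f) u : ℝ) := by
            by_contra! hle
            exact hs (Finset.mem_filter.2 ⟨huF, hle⟩)
          have hd : (degIn s (F f) u : ℝ) = ∑ v ∈ N, if f v = 0 then (1 : ℝ) else 0 := by
            rw [Finset.sum_boole, degIn, hN, hF]
            congr 2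
            ext v
            simp only [Finset.mem_filter]
            tauto
          simp only [h0, hs, if_true, if_false, true_and, ← hd]
          linarith
      · simp only [h0, if_false, mul_zero, false_and, Finset.sum_const_zero, add_zero]
        split_ifs <;> simp [hm.le]
    have h := Finset.sum_le_sum fun f (_ : f ∈ (Finset.univ : Finset (V → Fin n))) => hpt f
    rw [Finset.sum_add_distrib, ← Finset.mul_sum, ← Finset.mul_sum, Finset.sum_comm] at h
    simpa only [Finset.sum_boole] using h
  have hBsum : (∑ v ∈ N, ((B v).card : ℝ)) * n ^ 2 = degIn s U u * T := by
    rw [Finset.sum_mul, Finset.sum_congr rfl hBc, Finset.sum_const, nsmul_eq_mul]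
    rfl
  -- `A` has `T / n` elements, while the pairs number `degIn s U u * T / n ^ 2`, at most `m * T / (2
  -- * n)`. Thus at least half of `A` is good.
  have hgood : T ≤ 2 * n * Good.card := by
    have h1 : m * (A.card : ℝ) * n ^ 2 ≤ m * Good.card * n ^ 2 + degIn s U u * T := by
      rw [← hBsum, ← add_mul]
      exact mul_le_mul_of_nonneg_right hcount (by positivity)
    have h2 : m * (A.card : ℝ) * n ^ 2 = m * n * T := by rw [← hAc]; ring
    have h3 : 2 * (degIn s U u : ℝ) * T ≤ n * m * T := mul_le_mul_of_nonneg_right hdeg hTpos.le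
    have h4 : (n * m) * T ≤ (n * m) * (2 * n * Good.card) := by nlinarith
    exact le_of_mul_le_mul_left h4 (by positivity)
  have hval : (expect (sample n U) fun S => if u ∈ sparse s S m then (1 : ℝ≥0∞) else 0) =
      Good.card * ((n ^ Fintype.card V : ℕ) : ℝ≥0∞)⁻¹ := by
    rw [sample, expect_map, expect, tsum_fintype]
    simp only [PMF.uniformOfFintype_apply, mul_ite, mul_one, mul_zero]
    rw [← Finset.sum_filter, Finset.sum_const, nsmul_eq_mul, Fintype.card_fun, Fintype.card_fin]
  rw [hval]
  have hT0 : ((n ^ Fintype.card V : ℕ) : ℝ≥0∞) ≠ 0 :=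
    Nat.cast_ne_zero.2 (pow_ne_zero _ (NeZero.ne n))
  rw [← div_eq_mul_inv, ENNReal.le_div_iff_mul_le (Or.inl hT0)
    (Or.inl (ENNReal.natCast_ne_top _)), mul_comm, ← div_eq_mul_inv]
  refine ENNReal.div_le_of_le_mul ?_
  have : n ^ Fintype.card V ≤ Good.card * (2 * n) := by
    have : ((n ^ Fintype.card V : ℕ) : ℝ) ≤ ((Good.card * (2 * n) : ℕ) : ℝ) := by
      push_cast
      linarith
    exact_mod_cast this
  exact_mod_cast this

/-- `s` arises from `r` by moving lower marked vertices to lower levels. -/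
structure Lowered (b : ℕ) (r s : State V Δ) : Prop where
  graph : s.graph = r.graph
  mrkdL : s.mrkdL = r.mrkdL
  record : s.record = r.record
  level : ∀ v, s.level v = r.level v ∨ ∃ i, v ∈ r.mrkdL i ∧ s.level v = max b (i - 4)

theorem lower_support {b i : ℕ} {s t : State V Δ} (ht : t ∈ (lower b i s).support) :
    ∃ M ⊆ s.mrkdL i, t = s.moveTo M (max b (i - 4)) := by
  obtain ⟨S, hS, rfl⟩ := (PMF.mem_support_map_iff _ _ _).1 ht
  exact ⟨_, (Finset.filter_subset _ _).trans (sample_support_subset hS), rfl⟩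

theorem Lowered.of_mem_lower {b i : ℕ} {r s t : State V Δ} (h : Lowered b r s)
    (ht : t ∈ (lower b i s).support) : Lowered b r t := by
  obtain ⟨M, hM, rfl⟩ := lower_support ht
  refine ⟨h.graph, h.mrkdL, h.record, fun v => ?_⟩
  change (if v ∈ M then max b (i - 4) else s.level v) = _ ∨ ∃ j, _ ∧
    (if v ∈ M then max b (i - 4) else s.level v) = _
  split_ifs with hv
  · exact Or.inr ⟨i, h.mrkdL ▸ hM hv, rfl⟩
  · exact h.level v

theorem Lowered.of_mem_pass {b : ℕ} {l : List ℕ} {r s t : State V Δ} (h : Lowered b r s)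
    (ht : t ∈ (forLoop (lower b) l s).support) : Lowered b r t :=
  forLoop_invariant (P := Lowered b r) (fun _ _ _ hs _ ht => hs.of_mem_lower ht) h ht

/-- A lower marked vertex with few lower marked neighbors is lowered with constant probability. -/
theorem le_expect_lowerPass {b i : ℕ} {r : State V Δ} {u : V} (hu : u ∈ r.mrkdL i)
    (huniq : ∀ j, u ∈ r.mrkdL j → j = i) (hdeg : degIn r (r.mrkdL i) u ≤ 3 ^ (i + 2))
    {l : List ℕ} (hi : i ∈ l) {s : State V Δ} (hs : Lowered b r s) :
    ((2 * (2 * 3 ^ 6) : ℕ) : ℝ≥0∞)⁻¹ ≤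
      expect (forLoop (lower b) l s) fun t => if t.level u = max b (i - 4) then 1 else 0 := by
  -- Since `u` is in the table of level `i` only, no later step can send it to another level.
  have stay : ∀ l : List ℕ, ∀ s : State V Δ, s.mrkdL = r.mrkdL → s.level u = max b (i - 4) →
      ∀ t ∈ (forLoop (lower b) l s).support, t.level u = max b (i - 4) := by
    intro l s hs1 hs2 t ht
    refine (forLoop_invariant
      (P := fun s => s.mrkdL = r.mrkdL ∧ s.level u = max b (i - 4)) ?_ ⟨hs1, hs2⟩ ht).2
    intro j _ s hs t ht
    obtain ⟨M, hM, rfl⟩ := lower_support ht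
    refine ⟨hs.1, ?_⟩
    change (if u ∈ M then max b (j - 4) else s.level u) = _
    split_ifs with huM
    · rw [huniq j (hs.1 ▸ hM huM)]
    · exact hs.2
  induction l generalizing s with
  | nil => simp at hi
  | cons j l ih =>
    rw [forLoop, expect_bind]
    by_cases hij : i = j
    · subst hij
      -- On average at most `3 ^ (i + 2) / (2 * 3 ^ 6)` neighbors are sampled, half the threshold `3
      -- ^ (i - 4)`. Only the graph and the table enter, and earlier steps change neither.
      have hsp := le_expect_mem_sparse (n := 2 * 3 ^ 6) s (U := s.mrkdL i) (u := u)
        (hs.mrkdL ▸ hu) (m := (3 : ℝ) ^ ((i : ℤ) - 4)) (by positivity) (by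
          have h1 : degIn s (s.mrkdL i) u = degIn r (r.mrkdL i) u := by
            rw [degIn, degIn, hs.graph, hs.mrkdL]
          have h2 : ((degIn r (r.mrkdL i) u : ℕ) : ℝ) ≤ (3 : ℝ) ^ (i + 2) := by
            exact_mod_cast hdeg
          have h3 : (3 : ℝ) ^ (i + 2) = 3 ^ 6 * (3 : ℝ) ^ ((i : ℤ) - 4) := by
            rw [← zpow_natCast, ← zpow_natCast, ← zpow_add₀ (by norm_num)]
            congr 1
            push_cast
            ring
          rw [h1]
          push_cast
          nlinarith)
      refine hsp.trans ?_
      rw [lower, expect_map]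
      refine expect_mono fun S hS => ?_
      split_ifs with hmem
      · rw [expect_congr (Y := fun _ => 1), expect_const]
        intro t ht
        refine if_pos (stay l _ ?_ ?_ t ht)
        · exact hs.mrkdL
        · exact if_pos hmem
      · exact zero_le
    · have hil : i ∈ l := (List.mem_cons.1 hi).resolve_left hij
      calc ((2 * (2 * 3 ^ 6) : ℕ) : ℝ≥0∞)⁻¹
          = expect (lower b j s) fun _ => ((2 * (2 * 3 ^ 6) : ℕ) : ℝ≥0∞)⁻¹ := (expect_const _ _).symm
        _ ≤ _ := expect_mono fun t ht => ih hil (hs.of_mem_lower ht)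

/-! ### The cost of a batch -/

/-- The upper marked vertices. -/
def upperMarked (s : State V Δ) : Finset V := Finset.univ.filter fun u => ∃ i, u ∈ s.mrkdU i

/-- The lower marked vertices. -/
def lowerMarked (s : State V Δ) : Finset V := Finset.univ.filter fun u => ∃ i, u ∈ s.mrkdL i

theorem mem_upperMarked {s : State V Δ} {u : V} : u ∈ upperMarked s ↔ ∃ i, u ∈ s.mrkdU i := by
  simp [upperMarked]

theorem mem_lowerMarked {s : State V Δ} {u : V} : u ∈ lowerMarked s ↔ ∃ i, u ∈ s.mrkdL i := by
  simp [lowerMarked]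

theorem disjoint_marked {b : ℕ} {s : State V Δ} (h : WellMarked b s) :
    Disjoint (upperMarked s) (lowerMarked s) := by
  rw [Finset.disjoint_left]
  intro u hu hl
  obtain ⟨i, hi⟩ := mem_upperMarked.1 hu
  obtain ⟨j, hj⟩ := mem_lowerMarked.1 hl
  exact (h.upper i u hi).2 (h.lower j u hj).2.1

theorem filter_dirty_recolored {b : ℕ} {s : State V Δ} (h : WellMarked b s) :
    (s.recolored.filter fun u => ¬ s.Clean b u) = upperMarked s ∪ lowerMarked s := by
  ext u
  simp only [Finset.mem_filter, Finset.mem_union, mem_upperMarked, mem_lowerMarked, recolored,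
    Finset.mem_univ, true_and]
  constructor
  · rintro ⟨⟨i, hi | hi | hi⟩, hd⟩
    · exact Or.inl ⟨i, hi⟩
    · exact Or.inr ⟨i, hi⟩
    · exact absurd (h.clean i u hi).2 hd
  · rintro (⟨i, hi⟩ | ⟨i, hi⟩)
    · exact ⟨⟨i, Or.inl hi⟩, fun hc => (h.upper i u hi).2 hc.1⟩
    · exact ⟨⟨i, Or.inr (Or.inl hi)⟩, fun hc => (h.lower i u hi).2.2 hc.2⟩

theorem sumDirty_closeBatch {b : ℕ} {s s' : State V Δ} (h : WellMarked b s) (f : Stamp → ℕ) :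
    sumDirty f (closeBatch b s s') =
      sumDirty f s' + ∑ u ∈ upperMarked s ∪ lowerMarked s, (f (s.stamp b s' u) : ℝ≥0∞) := by
  rw [← filter_dirty_recolored h, Finset.sum_filter, ← Finset.univ_inter s.recolored,
    ← Finset.sum_ite_mem, sumDirty, sumDirty, ← Finset.sum_add_distrib]
  refine Finset.sum_congr rfl fun u _ => ?_
  by_cases hu : u ∈ s.recolored
  · by_cases hc : s.Clean b u
    · simp [closeBatch, hu, hc, stamp]
    · simp [closeBatch, hu, hc, stamp, add_comm]
  · simp [closeBatch, hu]

theorem sumDirty_congr {s s' : State V Δ} (h : s'.record = s.record) (f : Stamp → ℕ) :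
    sumDirty f s' = sumDirty f s := by
  simp only [sumDirty, h]

/-- The upper marked neighbors of `u` that are raised to a level not below the level of `u`; the
costs of `u` are charged to them. -/
def chargedTo (r t : State V Δ) (u : V) : Finset V :=
  (upperMarked r).filter fun v => r.level v < t.level v ∧ u ∈ t.below v (t.level v)

/-- The base level therefore exceeds the level by at least two, so the logarithm attains the maximum
and reaching the base level is a genuine move. -/
theorem le_log_card_of_not_upper {r : State V Δ} {u : V} (hu : ¬ r.Upper u) :
    r.level u + 2 ≤ Nat.log 3 (r.below u (r.level u)).card :=
  Nat.le_log_of_pow_le (by norm_num) (not_le.1 hu).le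

theorem two_mul_cost_le {b : ℕ} {r t s' : State V Δ} (hrt : Raised r t) {u : V}
    (hu : ¬ r.Upper u) (hs : Settled t u) (hfin : s'.level u = t.level u) :
    2 * (r.stamp b s' u).cost ≤
      2 * (r.stamp b s' u).moveCost + 3 * (chargedTo r t u).card := by
  have hlog := le_log_card_of_not_upper hu
  have hle := hrt.le u
  have hbase : (r.stamp b s' u).base = Nat.log 3 (r.below u (r.level u)).card :=
    max_eq_left (by omega)
  have hfinal : (r.stamp b s' u).final = t.level u := hfin
  have hlevel : (r.stamp b s' u).level = r.level u := rfl
  rw [Stamp.cost, Stamp.moveCost, hbase, hfinal, hlevel]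
  set d := Nat.log 3 (r.below u (r.level u)).card with hd
  by_cases hdl : d ≤ t.level u
  -- `u` rose at least to its base level, so cost and movement cost are both `3 ^ t.level u`.
  · rw [if_neg (by omega), max_eq_right hdl, max_eq_right hle]
    omega
  · rw [max_eq_left (by omega : t.level u ≤ d)]
    have h1 : 3 ^ d ≤ (r.below u (r.level u)).card := by
      refine Nat.pow_log_le_self 3 fun h0 => ?_
      rw [hd, h0, Nat.log_zero_right] at hlog
      omega
    -- The neighbors lost by `u` were raised past its new level. At least `3 ^ d - 3 ^ (d - 1)` were
    -- lost, since `u` is settled below level `d`.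
    have h2 : r.below u (r.level u) \ t.below u (t.level u) ⊆ chargedTo r t u := by
      intro v hv
      obtain ⟨hv1, hv2⟩ := Finset.mem_sdiff.1 hv
      rw [mem_below] at hv1 hv2
      rw [hrt.graph] at hv2
      have hlt : t.level u < t.level v := by
        by_contra! h
        exact hv2 ⟨hv1.1, h⟩
      refine Finset.mem_filter.2 ⟨mem_upperMarked.2 (hrt.moved v (by omega)), by omega, ?_⟩
      rw [mem_below, hrt.graph]
      exact ⟨hv1.1.symm, hlt.le⟩
    have h3 := Finset.le_card_sdiff (t.below u (t.level u)) (r.below u (r.level u))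
    have h4 := Finset.card_le_card h2
    have h5 : (t.below u (t.level u)).card ≤ 3 ^ t.level u := hs
    have h6 : 3 * 3 ^ t.level u ≤ 3 ^ d := by
      rw [← pow_succ']
      exact Nat.pow_le_pow_right (by norm_num) (by omega)
    omega

/-- The costs of the upper marked vertices are dominated by their movement costs. -/
theorem sum_cost_upperMarked_le {b : ℕ} {r t s' : State V Δ} (hr : WellMarked b r)
    (hrt : Raised r t) (hs : ∀ i, ∀ u ∈ r.mrkdU i, Settled t u)
    (hfin : ∀ u ∈ upperMarked r, s'.level u = t.level u) :
    ∑ u ∈ upperMarked r, (r.stamp b s' u).cost ≤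
      3 * ∑ u ∈ upperMarked r, (r.stamp b s' u).moveCost := by
  have hcharge : ∑ u ∈ upperMarked r, (chargedTo r t u).card ≤
      ∑ v ∈ upperMarked r, (r.stamp b s' v).moveCost := by
    -- Double counting: `v` is charged only by its neighbors up to its new level, and there are at
    -- most `3 ^ t.level v` of them because `v` is settled.
    have hswap : ∑ u ∈ upperMarked r, (chargedTo r t u).card =
        ∑ v ∈ upperMarked r, ((upperMarked r).filter fun u =>
          r.level v < t.level v ∧ u ∈ t.below v (t.level v)).card := by
      simp only [chargedTo, Finset.card_filter]
      exact Finset.sum_comm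
    rw [hswap]
    refine Finset.sum_le_sum fun v hv => ?_
    by_cases hlt : r.level v < t.level v
    · have h1 : (r.stamp b s' v).moveCost = 3 ^ t.level v := by
        have hfinal : (r.stamp b s' v).final = t.level v := hfin v hv
        have hlevel : (r.stamp b s' v).level = r.level v := rfl
        rw [Stamp.moveCost, hfinal, hlevel, if_neg hlt.ne', max_eq_right hlt.le]
      obtain ⟨i, hi⟩ := mem_upperMarked.1 hv
      rw [h1]
      refine (Finset.card_le_card fun u hu => ?_).trans (hs i v hi)
      exact (Finset.mem_filter.1 hu).2.2
    · simp [hlt]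
  have hsum : ∑ u ∈ upperMarked r, 2 * (r.stamp b s' u).cost ≤ ∑ u ∈ upperMarked r,
      (2 * (r.stamp b s' u).moveCost + 3 * (chargedTo r t u).card) := by
    refine Finset.sum_le_sum fun u hu => ?_
    obtain ⟨i, hi⟩ := mem_upperMarked.1 hu
    exact two_mul_cost_le hrt (hr.upper i u hi).2 (hs i u hi) (hfin u hu)
  rw [Finset.sum_add_distrib, ← Finset.mul_sum, ← Finset.mul_sum, ← Finset.mul_sum] at hsum
  -- The factor obtained is `5 / 2`, rounded up to `3`.
  omega

theorem cost_lowerMarked_le {b i : ℕ} {r s' : State V Δ} (hr : WellMarked b r) {u : V}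
    (hu : u ∈ r.mrkdL i) (hfin : s'.level u ≤ i) :
    (r.stamp b s' u).cost ≤ 9 * 3 ^ i := by
  obtain ⟨hl, hup, -⟩ := hr.lower i u hu
  have hlog : Nat.log 3 (r.below u (r.level u)).card ≤ i + 2 := by
    refine (Nat.log_mono_right hup).trans ?_
    rw [Nat.log_pow (by norm_num), hl]
  calc 3 ^ max (r.baseLevel u) (s'.level u) ≤ 3 ^ (i + 2) :=
        Nat.pow_le_pow_right (by norm_num)
          (max_le (max_le hlog (by omega)) (by omega))
    _ = 9 * 3 ^ i := by ring

/-- The lower condition is void on the bottom level. Hence the target `max b (i - 4)` lies strictly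
below `i`, and lowering has positive movement cost. -/
theorem lt_of_mem_mrkdL {b i : ℕ} {r : State V Δ} (hr : WellMarked b r) {u : V}
    (hu : u ∈ r.mrkdL i) : b < i := by
  obtain ⟨hl, -, hlow⟩ := hr.lower i u hu
  by_contra! h
  exact hlow fun h' => absurd h' (by omega)

theorem moveCost_lowered {b i : ℕ} {r s' : State V Δ} (hr : WellMarked b r) {u : V}
    (hb : 1 ≤ b) (hu : u ∈ r.mrkdL i) (hfin : s'.level u = max b (i - 4)) :
    3 ^ i ≤ (r.stamp b s' u).moveCost := by
  have hbi := lt_of_mem_mrkdL hr hu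
  have hlevel : (r.stamp b s' u).level = i := (hr.lower i u hu).1
  have hfinal : (r.stamp b s' u).final = max b (i - 4) := hfin
  rw [Stamp.moveCost, hfinal, hlevel, if_neg (by omega)]
  exact Nat.pow_le_pow_right (by norm_num) (le_max_left _ _)

/-- What is needed about the state at the start of the moving phase. -/
structure Ready (b : ℕ) (r : State V Δ) : Prop where
  marked : WellMarked b r
  level : ∀ v, b ≤ r.level v ∧ r.level v ≤ topLevel Δ
  deg : ∀ u j, (r.below u j).card ≤ 3 ^ topLevel Δ

theorem le_topLevel {b : ℕ} (hb : b ≤ 5) : b ≤ topLevel Δ := hb.trans (le_max_left _ _)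

theorem Ready.move {b : ℕ} (hb : 1 ≤ b) (hb5 : b ≤ 5) {r s' : State V Δ} (hr : Ready b r)
    (hs' : s' ∈ (movePhase b r).support) :
    s'.graph = r.graph ∧ s'.record = r.record ∧
      (∀ v, b ≤ s'.level v ∧ s'.level v ≤ topLevel Δ) ∧
      (∀ i, ∀ u ∈ r.mrkdL i, s'.level u ≤ i) ∧
      ∃ t, Raised r t ∧ (∀ i, ∀ u ∈ r.mrkdU i, Settled t u) ∧
        ∀ u ∈ upperMarked r, s'.level u = t.level u := by
  obtain ⟨t, ht, hts⟩ := (PMF.mem_support_bind_iff _ _ _).1 hs'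
  obtain ⟨hrt, hset⟩ := raisePass_spec hb ((le_topLevel hb5).trans (Nat.le_succ _)) hr.marked
    hr.level hr.deg ht
  have hl : Lowered b t s' :=
    Lowered.of_mem_pass ⟨rfl, rfl, rfl, fun v => Or.inl rfl⟩ hts
  refine ⟨hl.graph.trans hrt.graph, hl.record.trans hrt.record, fun v => ?_, fun i u hu => ?_,
    t, hrt, hset, fun u hu => ?_⟩
  · rcases hl.level v with h | ⟨i, hi, h⟩
    · rw [h]
      exact ⟨(hr.level v).1.trans (hrt.le v), hrt.top v⟩
    · rw [hrt.mrkdL] at hi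
      have h1 := (hr.marked.lower i v hi).1
      have h2 := (hr.level v).2
      have h3 := le_topLevel (Δ := Δ) hb5
      omega
  · have hbi := lt_of_mem_mrkdL hr.marked hu
    have hi := (hr.marked.lower i u hu)
    rcases hl.level u with h | ⟨j, hj, h⟩
    · rw [h]
      by_contra! hlt
      obtain ⟨k, hk⟩ := hrt.moved u (by omega)
      exact (hr.marked.upper k u hk).2 hi.2.1
    · rw [hrt.mrkdL] at hj
      have := (hr.marked.lower j u hj).1
      omega
  · refine (hl.level u).resolve_right ?_
    rintro ⟨i, hi, -⟩
    rw [hrt.mrkdL] at hi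
    exact Finset.disjoint_left.1 (disjoint_marked hr.marked) hu (mem_lowerMarked.2 ⟨i, hi⟩)

theorem Ready.le_expect_moveCost {b i : ℕ} (hb : 1 ≤ b) (hb5 : b ≤ 5) {r : State V Δ}
    (hr : Ready b r) {u : V} (hu : u ∈ r.mrkdL i) :
    (9 * 3 ^ i : ℕ) ≤ (26244 : ℝ≥0∞) *
      expect (movePhase b r) fun s' => ((r.stamp b s' u).moveCost : ℝ≥0∞) := by
  have huniq : ∀ j, u ∈ r.mrkdL j → j = i := fun j hj =>
    (hr.marked.lower j u hj).1.symm.trans (hr.marked.lower i u hu).1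
  have hi := hr.marked.lower i u hu
  -- Lower marked neighbors from the same table are on level `i`, so the upper condition for `u`
  -- counts them.
  have hdeg : degIn r (r.mrkdL i) u ≤ 3 ^ (i + 2) := by
    have hup := hi.2.1
    unfold Upper at hup
    rw [hi.1] at hup
    refine (Finset.card_le_card fun v hv => ?_).trans hup
    obtain ⟨h1, h2⟩ := Finset.mem_filter.1 hv
    exact mem_below.2 ⟨h2, (hr.marked.lower i v h1).1.le⟩
  have hmem : i ∈ levelsUp b (topLevel Δ) :=
    mem_levelsUp.2 ⟨hi.1 ▸ (hr.level u).1, hi.1 ▸ (hr.level u).2⟩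
  -- Raising changes neither the graph nor the lower marked tables, so the lowering bound applies
  -- after every outcome of the raising pass.
  have key : ((2 * (2 * 3 ^ 6) : ℕ) : ℝ≥0∞)⁻¹ ≤
      expect (movePhase b r) fun t => if t.level u = max b (i - 4) then 1 else 0 := by
    rw [movePhase, expect_bind, ← expect_const (forLoop raise (levelsDown b (topLevel Δ)) r)
      (((2 * (2 * 3 ^ 6) : ℕ) : ℝ≥0∞)⁻¹)]
    refine expect_mono fun t ht => ?_
    obtain ⟨hrt, -⟩ := raisePass_spec hb ((le_topLevel hb5).trans (Nat.le_succ _)) hr.marked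
      hr.level hr.deg ht
    refine le_expect_lowerPass (r := t) ?_ ?_ ?_ hmem ⟨rfl, rfl, rfl, fun v => Or.inl rfl⟩
    · rwa [hrt.mrkdL]
    · rwa [hrt.mrkdL]
    · rwa [degIn, hrt.mrkdL, hrt.graph]
  have hmono : ((3 ^ i : ℕ) : ℝ≥0∞) * ((2 * (2 * 3 ^ 6) : ℕ) : ℝ≥0∞)⁻¹ ≤
      expect (movePhase b r) fun s' => ((r.stamp b s' u).moveCost : ℝ≥0∞) := by
    refine le_trans (mul_le_mul_right key _) ?_
    rw [← expect_const_mul]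
    refine expect_mono fun s' _ => ?_
    split_ifs with h
    · rw [mul_one]
      exact_mod_cast moveCost_lowered hr.marked hb hu h
    · simp
  refine le_trans (le_of_eq ?_) (mul_le_mul_right hmono _)
  rw [show (26244 : ℝ≥0∞) = 9 * ((2 * (2 * 3 ^ 6) : ℕ) : ℝ≥0∞) by norm_num]
  rw [mul_mul_mul_comm, mul_comm (((2 * (2 * 3 ^ 6) : ℕ) : ℝ≥0∞)), mul_assoc,
    ENNReal.inv_mul_cancel (by norm_num) (ENNReal.natCast_ne_top _)]
  push_cast
  ring

/-- The expected costs of a batch are dominated by the expected movement costs. -/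
theorem Ready.expect_cost_le {b : ℕ} (hb : 1 ≤ b) (hb5 : b ≤ 5) {r : State V Δ}
    (hr : Ready b r) :
    (expect (movePhase b r) fun s' => ∑ u ∈ upperMarked r ∪ lowerMarked r,
      ((r.stamp b s' u).cost : ℝ≥0∞)) ≤
    26244 * expect (movePhase b r) fun s' => ∑ u ∈ upperMarked r ∪ lowerMarked r,
      ((r.stamp b s' u).moveCost : ℝ≥0∞) := by
  simp only [Finset.sum_union (disjoint_marked hr.marked)]
  rw [expect_add, expect_add, mul_add]
  refine add_le_add ?_ ?_
  · rw [← expect_const_mul]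
    refine expect_mono fun s' hs' => ?_
    obtain ⟨-, -, -, -, t, hrt, hset, hfin⟩ := hr.move hb hb5 hs'
    have h := sum_cost_upperMarked_le hr.marked hrt hset hfin
    have h' : ∑ u ∈ upperMarked r, (r.stamp b s' u).cost ≤
        26244 * ∑ u ∈ upperMarked r, (r.stamp b s' u).moveCost := by omega
    exact_mod_cast h'
  · rw [expect_finset_sum, expect_finset_sum, Finset.mul_sum]
    refine Finset.sum_le_sum fun u hu => ?_
    obtain ⟨i, hi⟩ := mem_lowerMarked.1 hu
    refine le_trans ?_ (hr.le_expect_moveCost hb hb5 hi)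
    rw [← expect_const (movePhase b r) ((9 * 3 ^ i : ℕ) : ℝ≥0∞)]
    refine expect_mono fun s' hs' => ?_
    exact_mod_cast cost_lowerMarked_le hr.marked hi ((hr.move hb hb5 hs').2.2.2.1 i u hi)

/-! ### The whole run -/

theorem ready_of_recolored {b : ℕ} {B : Batch V} {s r : State V Δ}
    (hlev : ∀ v, b ≤ s.level v ∧ s.level v ≤ topLevel Δ)
    (hdeg : ∀ v, ((B.apply s.graph).neighborSet v).ncard ≤ Δ)
    (hr : Recolored b (initPhase b B s) r) : Ready b r := by
  refine ⟨hr.marked, fun v => ?_, fun u j => ?_⟩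
  · rw [hr.level]
    exact hlev v
  · have hg : r.graph = B.apply s.graph := hr.graph
    have h1 : (r.below u j).card ≤ ((B.apply s.graph).neighborSet u).ncard := by
      rw [← Set.ncard_coe_finset]
      refine Set.ncard_le_ncard (fun v hv => ?_) (Set.toFinite _)
      rw [← hg]
      exact (mem_below.1 hv).1
    calc (r.below u j).card ≤ Δ := h1.trans (hdeg u)
      _ ≤ 3 ^ Nat.clog 3 Δ := Nat.le_pow_clog (by norm_num) Δ
      _ ≤ 3 ^ topLevel Δ := Nat.pow_le_pow_right (by norm_num) (le_max_right _ _)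

theorem update_support {b k : ℕ} (hb : 1 ≤ b) (hb5 : b ≤ 5) {arr : Arrangement V Δ}
    {B : Batch V} {s s' : State V Δ} (hlev : ∀ v, b ≤ s.level v ∧ s.level v ≤ topLevel Δ)
    (hdeg : ∀ v, ((B.apply s.graph).neighborSet v).ncard ≤ Δ)
    (hs' : s' ∈ (update b arr k B s).support) :
    s'.graph = B.apply s.graph ∧ ∀ v, b ≤ s'.level v ∧ s'.level v ≤ topLevel Δ := by
  obtain ⟨r, hr, hs'⟩ := (PMF.mem_support_bind_iff _ _ _).1 hs'
  obtain ⟨t, ht, rfl⟩ := (PMF.mem_support_map_iff _ _ _).1 hs'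
  have hrec := (recolored_initPhase b B s).of_mem_colorPhase hr
  obtain ⟨h1, -, h3, -⟩ := (ready_of_recolored hlev hdeg hrec).move hb hb5 ht
  exact ⟨h1.trans hrec.graph, h3⟩

theorem expect_update {b k : ℕ} (hb : 1 ≤ b) (hb5 : b ≤ 5) {arr : Arrangement V Δ}
    {B : Batch V} {s : State V Δ} (hlev : ∀ v, b ≤ s.level v ∧ s.level v ≤ topLevel Δ)
    (hdeg : ∀ v, ((B.apply s.graph).neighborSet v).ncard ≤ Δ) (f : Stamp → ℕ) :
    expect (update b arr k B s) (sumDirty f) =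
      sumDirty f s + expect (colorPhase b arr k (initPhase b B s)) fun r =>
        expect (movePhase b r) fun s' => ∑ u ∈ upperMarked r ∪ lowerMarked r,
          (f (r.stamp b s' u) : ℝ≥0∞) := by
  rw [update, expect_bind, ← expect_const (colorPhase b arr k (initPhase b B s)) (sumDirty f s),
    ← expect_add]
  refine expect_congr fun r hr => ?_
  have hrec := (recolored_initPhase b B s).of_mem_colorPhase hr
  rw [expect_map, ← expect_const (movePhase b r) (sumDirty f s), ← expect_add]
  refine expect_congr fun s' hs' => ?_
  rw [sumDirty_closeBatch hrec.marked]
  congr 1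
  have h := ((ready_of_recolored hlev hdeg hrec).move hb hb5 hs').2.1
  exact sumDirty_congr (h.trans hrec.record) f

/-- An arbitrary initial law for which the inequality already holds lets the induction absorb one
batch at a time into `p`. -/
theorem expect_runFrom_le {b : ℕ} (hb : 1 ≤ b) (hb5 : b ≤ 5) {arr : Arrangement V Δ}
    (l : List (Batch V)) (k : ℕ) (p : PMF (State V Δ))
    (hp : ∀ s ∈ p.support, (∀ v, b ≤ s.level v ∧ s.level v ≤ topLevel Δ) ∧ Valid Δ s.graph l)
    (h : expect p dirtyCost ≤ 26244 * expect p dirtyMoveCost) :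
    expect (p.bind (runFrom b arr k l)) dirtyCost ≤
      26244 * expect (p.bind (runFrom b arr k l)) dirtyMoveCost := by
  induction l generalizing k p with
  | nil =>
    have : runFrom b arr k [] = PMF.pure := rfl
    rwa [this, PMF.bind_pure]
  | cons B l ih =>
    have hsplit : p.bind (runFrom b arr k (B :: l)) =
        (p.bind (update b arr k B)).bind (runFrom b arr (k + 1) l) := by
      rw [PMF.bind_bind]
      rfl
    rw [hsplit]
    refine ih (k + 1) _ (fun s' hs' => ?_) ?_
    · obtain ⟨s, hs, hs'⟩ := (PMF.mem_support_bind_iff _ _ _).1 hs'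
      obtain ⟨hlev, -, -, hdeg, hval⟩ := hp s hs
      obtain ⟨hg, hlev'⟩ := update_support hb hb5 hlev hdeg hs'
      exact ⟨hlev', hg ▸ hval⟩
    · have hexp : ∀ f : Stamp → ℕ, expect (p.bind (update b arr k B)) (sumDirty f) =
          expect p (sumDirty f) + expect p fun s =>
            expect (colorPhase b arr k (initPhase b B s)) fun r =>
              expect (movePhase b r) fun s' => ∑ u ∈ upperMarked r ∪ lowerMarked r,
                (f (r.stamp b s' u) : ℝ≥0∞) := by
        intro f
        rw [expect_bind, ← expect_add]
        refine expect_congr fun s hs => ?_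
        obtain ⟨hlev, -, -, hdeg, -⟩ := hp s hs
        exact expect_update hb hb5 hlev hdeg f
      change expect _ (sumDirty Stamp.cost) ≤ _ * expect _ (sumDirty Stamp.moveCost)
      rw [hexp, hexp, mul_add]
      refine add_le_add h ?_
      rw [← expect_const_mul]
      refine expect_mono fun s hs => ?_
      obtain ⟨hlev, -, -, hdeg, -⟩ := hp s hs
      rw [← expect_const_mul]
      refine expect_mono fun r hr => ?_
      exact (ready_of_recolored hlev hdeg
        ((recolored_initPhase b B s).of_mem_colorPhase hr)).expect_cost_le hb hb5

theorem expect_run_le {b : ℕ} (hb : 1 ≤ b) (hb5 : b ≤ 5) (arr : Arrangement V Δ)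
    (S : List (Batch V)) (hS : Valid Δ ⊥ S) :
    expect (run b arr S) dirtyCost ≤ 26244 * expect (run b arr S) dirtyMoveCost := by
  refine expect_runFrom_le hb hb5 S 1 (start V Δ) (fun s hs => ?_) ?_
  · obtain ⟨f, -, rfl⟩ := (PMF.mem_support_map_iff _ _ _).1 hs
    exact ⟨fun _ => ⟨hb5, le_max_left _ _⟩, hS⟩
  -- All records are empty at the start, so both sides vanish.
  · rw [start, expect_map, expect_map]
    simp [dirtyCost, dirtyMoveCost, sumDirty, expect]

end BatchColoring

end

theorem mainTheorem7 :
    ∃ C : ℝ≥0, ∀ (V : Type*) [Fintype V] [LinearOrder V] (Δ b : ℕ)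
      (arr : BatchColoring.Arrangement V Δ) (S : List (BatchColoring.Batch V)),
      1 ≤ b → b ≤ 5 → BatchColoring.Valid Δ ⊥ S →
        BatchColoring.expect (BatchColoring.run b arr S) BatchColoring.dirtyCost ≤
          C * BatchColoring.expect (BatchColoring.run b arr S) BatchColoring.dirtyMoveCost := by
  refine ⟨26244, fun V _ _ Δ b arr S hb hb5 hS => ?_⟩
  have h := BatchColoring.expect_run_le hb hb5 arr S hS
  exact_mod_cast h
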